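/- Let $\mathbb H$ be the quaternions and $\mathbb S=\{q\in\mathbb H: q^2=-1\}$; for $I\in\mathbb S$ and $T\subseteq\mathbb H$ put $T_I=T\cap(\mathbb R+I\mathbb R)$. A symmetric slice domain is a domain (a nonempty connected open set) $\Omega\subseteq\mathbb H$ that meets $\mathbb R$, such that each $\Omega_I$ is a domain in $\mathbb R+I\mathbb R$, and such that $x+Iy\in\Omega$ (with $x,y\in\mathbb R$, $I\in\mathbb S$) implies $x+Jy\in\Omega$ for all $J\in\mathbb S$. A function $f:\Omega\to\mathbb H$ is regular if for every $I\in\mathbb S$ the restriction $f_I=f|_{\Omega_I}$ has continuous partial derivatives and $\frac12\left(\frac{\partial}{\partial x}+I\frac{\partial}{\partial y}\right)f_I(x+Iy)=0$ on $\Omega_I$. Let $f,g$ be regular on a symmetric slice domain. For $I,J\in\mathbb S$ with $I\perp J$ write $f_I=F+GJ$, $g_I=H+KJ$ with $F,G,H,K:\Omega_I\to\mathbb R+I\mathbb R$ holomorphic. The $*$-product $f*g$ is the regular function whose restriction to $\Omega_I$ is $$\left[F(z)H(z)-G(z)\overline{K(\bar z)}\right]+\left[F(z)K(z)+G(z)\overline{H(\bar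 z)}\right]J ,$$ the regular conjugate $f^c$ is the regular function whose restriction to $\Omega_I$ is $\overline{F(\bar z)}-G(z)J$, and $f^s=f*f^c$; these functions exist, are unique, and do not depend on the choice of $I$ and $J$. For $f\not\equiv 0$ let $f^{-*}=\frac1{f^s}f^c$ on $\Omega\setminus Z_{f^s}$, where $Z_{f^s}$ is the zero set of $f^s$; the set $\Omega\setminus Z_{f^s}$ is again a symmetric slice domain and $f^{-*}$ is regular on it. **Theorem.** Let $\Omega$ be a symmetric slice domain and let $$\mathcal L(\Omega)=\{f^{-*}*g \;:\; f,g \text{ regular in } \Omega,\ f\not\equiv 0\},$$ where $f^{-*}*g$ is a regular function on $\Omega\setminus Z_{f^s}$, and two $*$-quotients are identified when they coincide on the intersection of their domains (this is an equivalence relation). The sum and the $*$-product of two $*$-quotients, taken on the intersection of their domains, are again $*$-quotients, and with these operations $\mathcal L(\Omega)$ is a division ring. The regular functions on $\Omega$ form a ring $D$ under $+$ and $*$, which is a left and right Ore domain: $D$ has no zero divisors, and $D*a\cap D*b\neq\{0\}$ and $a*D\cap b*D\neq\{0\}$ for all $a,b\in D\setminus\{0\}$. Finally, $\mathcal L(\Omega)$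 is the classical ring of quotients of $D$: the inclusion $f\mapsto f=1^{-*}*f$ is an injective ring homomorphism $D\to\mathcal L(\Omega)$, every nonzero $a\in D$ is invertible in $\mathcal L(\Omega)$, every element of $\mathcal L(\Omega)$ is of the form $a^{-1}*b$ and also of the form $c*d^{-1}$ with $a,b,c,d\in D$, $a,d\neq 0$, and the $*$-quotient $f^{-*}*g$ is the element $f^{-1}*g$. -/

import Mathlib

open scoped Quaternion

namespace SliceRegular

/-- The 2-sphere `𝕊` of imaginary units of the quaternions. -/
def imagUnits : Set ℍ[ℝ] := {q | q ^ 2 = -1}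

/-- The parametrization `x + iy ↦ x + I y` of the complex line `ℝ + I ℝ`. For an imaginary unit `I`
it is the isomorphism of `ℂ` with the subalgebra `ℝ + I ℝ`. -/
noncomputable def sliceMap (I : ℍ[ℝ]) (z : ℂ) : ℍ[ℝ] := (z.re : ℍ[ℝ]) + I * (z.im : ℍ[ℝ])

/-- The slice `U_I = U ∩ (ℝ + I ℝ)`, in the coordinate of `ℝ + I ℝ`. -/
def slice (U : Set ℍ[ℝ]) (I : ℍ[ℝ]) : Set ℂ := {z | sliceMap I z ∈ U}

/-- A domain of the quaternions that meets the real axis and all of whose slices are domains. -/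
structure IsSliceDomain (U : Set ℍ[ℝ]) : Prop where
  isOpen : IsOpen U
  isConnected : IsConnected U
  exists_real : ∃ r : ℝ, (r : ℍ[ℝ]) ∈ U
  isOpen_slice : ∀ I ∈ imagUnits, IsOpen (slice U I)
  isConnected_slice : ∀ I ∈ imagUnits, IsConnected (slice U I)

/-- Axial symmetry: with a point `x + I y` the set contains the whole sphere `x + y 𝕊`. -/
def IsAxiallySymmetric (U : Set ℍ[ℝ]) : Prop :=
  ∀ z : ℂ, ∀ I ∈ imagUnits, ∀ J ∈ imagUnits, sliceMap I z ∈ U → sliceMap J z ∈ U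

structure IsSymmetricSliceDomain (U : Set ℍ[ℝ]) : Prop extends IsSliceDomain U where
  symmetric : IsAxiallySymmetric U

open Classical in
/-- The restriction `f_I` of `f : U → ℍ` to the slice `U_I`, in the coordinate of `ℝ + I ℝ`
(with the value `0` off `U_I`; only the values on the open set `U_I` are used). -/
noncomputable def onSlice {U : Set ℍ[ℝ]} (f : U → ℍ[ℝ]) (I : ℍ[ℝ]) (z : ℂ) : ℍ[ℝ] :=
  if h : sliceMap I z ∈ U then f ⟨sliceMap I z, h⟩ else 0

/-- `(1/2) (∂/∂x + I ∂/∂y) φ`. -/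
noncomputable def dbar (I : ℍ[ℝ]) (φ : ℂ → ℍ[ℝ]) (z : ℂ) : ℍ[ℝ] :=
  (2⁻¹ : ℝ) • (fderiv ℝ φ z 1 + I * fderiv ℝ φ z Complex.I)

/-- Slice regularity: each restriction `f_I` is continuously differentiable and is annihilated
by the Cauchy–Riemann operator of `ℝ + I ℝ`. -/
def IsSliceRegular {U : Set ℍ[ℝ]} (f : U → ℍ[ℝ]) : Prop :=
  ∀ I ∈ imagUnits, ContDiffOn ℝ 1 (onSlice f I) (slice U I) ∧
    ∀ z ∈ slice U I, dbar I (onSlice f I) z = 0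

/-- The set of regular functions on `U`. -/
abbrev RegularFn (U : Set ℍ[ℝ]) : Type := {f : U → ℍ[ℝ] // IsSliceRegular f}

/-- `f_I = F + G J` on `U_I`, with `F`, `G` holomorphic from `U_I` to `ℝ + I ℝ`. -/
structure IsSplitting {U : Set ℍ[ℝ]} (f : U → ℍ[ℝ]) (I J : ℍ[ℝ]) (F G : ℂ → ℂ) : Prop where
  left : DifferentiableOn ℂ F (slice U I)
  right : DifferentiableOn ℂ G (slice U I)
  eq : ∀ z ∈ slice U I, onSlice f I z = sliceMap I (F z) + sliceMap I (G z) * J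

/-- `h` is the regular extension of `f_I * g_I`, for every choice of `I ⊥ J` and of splittings
`f_I = F + G J`, `g_I = H + K J`. -/
def IsStarProduct {U : Set ℍ[ℝ]} (f g h : U → ℍ[ℝ]) : Prop :=
  IsSliceRegular h ∧
  ∀ I ∈ imagUnits, ∀ J ∈ imagUnits, inner ℝ I J = 0 →
    ∀ F G H K : ℂ → ℂ, IsSplitting f I J F G → IsSplitting g I J H K →
      ∀ z ∈ slice U I, onSlice h I z =
        sliceMap I (F z * H z - G z * star (K (star z))) +
          sliceMap I (F z * K z + G z * star (H (star z))) * J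

/-- `h` is the regular extension of `f_I^c`, for every choice of `I ⊥ J` and of a splitting
`f_I = F + G J`. -/
def IsRegularConj {U : Set ℍ[ℝ]} (f h : U → ℍ[ℝ]) : Prop :=
  IsSliceRegular h ∧
  ∀ I ∈ imagUnits, ∀ J ∈ imagUnits, inner ℝ I J = 0 →
    ∀ F G : ℂ → ℂ, IsSplitting f I J F G →
      ∀ z ∈ slice U I, onSlice h I z =
        sliceMap I (star (F (star z))) - sliceMap I (G z) * J

/-- The `*`-product `f * g`. -/
noncomputable def starMul {U : Set ℍ[ℝ]} (f g : U → ℍ[ℝ]) : U → ℍ[ℝ] :=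
  Classical.epsilon (IsStarProduct f g)

/-- The regular conjugate `f^c`. -/
noncomputable def regConj {U : Set ℍ[ℝ]} (f : U → ℍ[ℝ]) : U → ℍ[ℝ] :=
  Classical.epsilon (IsRegularConj f)

/-- The symmetrization `f^s = f * f^c`. -/
noncomputable def symmetrization {U : Set ℍ[ℝ]} (f : U → ℍ[ℝ]) : U → ℍ[ℝ] :=
  starMul f (regConj f)

/-- `U` minus the zero set of `f^s`. -/
def recipDomain {U : Set ℍ[ℝ]} (f : U → ℍ[ℝ]) : Set ℍ[ℝ] :=
  {q | ∃ h : q ∈ U, symmetrization f ⟨q, h⟩ ≠ 0}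

theorem recipDomain_subset {U : Set ℍ[ℝ]} (f : U → ℍ[ℝ]) : recipDomain f ⊆ U :=
  fun _ h => h.1

/-- Restriction of a function to a smaller domain. -/
def res {U V : Set ℍ[ℝ]} (h : V ⊆ U) (f : U → ℍ[ℝ]) : V → ℍ[ℝ] := fun q => f ⟨q.1, h q.2⟩

/-- The regular reciprocal `f^{-*} = (1 / f^s) f^c`. -/
noncomputable def starInv {U : Set ℍ[ℝ]} (f : U → ℍ[ℝ]) : recipDomain f → ℍ[ℝ] := fun q =>
  (res (recipDomain_subset f) (symmetrization f) q)⁻¹ * res (recipDomain_subset f) (regConj f) q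

/-- A function on `U` as a partial function on the quaternions. -/
def toPFun {U : Set ℍ[ℝ]} (f : U → ℍ[ℝ]) : ℍ[ℝ] →. ℍ[ℝ] := fun q => ⟨q ∈ U, fun h => f ⟨q, h⟩⟩

/-- The `*`-quotient `f^{-*} * g`, a function on `U` minus the zero set of `f^s`. -/
noncomputable def starQuotient {U : Set ℍ[ℝ]} (f g : U → ℍ[ℝ]) : ℍ[ℝ] →. ℍ[ℝ] :=
  toPFun (starMul (starInv f) (res (recipDomain_subset f) g))

/-- The sum of two functions, on the intersection of their domains. -/
noncomputable def addPFun (φ ψ : ℍ[ℝ] →. ℍ[ℝ]) : ℍ[ℝ] →. ℍ[ℝ] :=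
  toPFun (U := φ.Dom ∩ ψ.Dom)
    (res Set.inter_subset_left φ.asSubtype + res Set.inter_subset_right ψ.asSubtype)

/-- The `*`-product of two functions, on the intersection of their domains. -/
noncomputable def starMulPFun (φ ψ : ℍ[ℝ] →. ℍ[ℝ]) : ℍ[ℝ] →. ℍ[ℝ] :=
  toPFun (U := φ.Dom ∩ ψ.Dom)
    (starMul (res Set.inter_subset_left φ.asSubtype) (res Set.inter_subset_right ψ.asSubtype))

/-- The set of `*`-quotients `f^{-*} * g` of regular functions on `U`, `f ≢ 0`. -/
def starQuotients (U : Set ℍ[ℝ]) : Set (ℍ[ℝ] →. ℍ[ℝ]) :=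
  {φ | ∃ f g : RegularFn U, f.1 ≠ 0 ∧ φ = starQuotient f.1 g.1}

/-- Two `*`-quotients are identified when they coincide wherever both are defined. -/
def SameQuotient (U : Set ℍ[ℝ]) (φ ψ : starQuotients U) : Prop :=
  ∀ q (hφ : q ∈ φ.1.Dom) (hψ : q ∈ ψ.1.Dom), φ.1.fn q hφ = ψ.1.fn q hψ

/-- `𝓛(U)`: the set of `*`-quotients, up to the identification above. -/
def QuotientRing (U : Set ℍ[ℝ]) : Type := Quot (SameQuotient U)

/-- The element of `𝓛(U)` given by a `*`-quotient. -/
def QuotientRing.of {U : Set ℍ[ℝ]} (φ : ℍ[ℝ] →. ℍ[ℝ]) (h : φ ∈ starQuotients U) :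
    QuotientRing U := Quot.mk _ ⟨φ, h⟩

theorem starQuotient_mem {U : Set ℍ[ℝ]} (f g : RegularFn U) (hf : f.1 ≠ 0) :
    starQuotient f.1 g.1 ∈ starQuotients U := ⟨f, g, hf, rfl⟩

end SliceRegular

/-- A domain `D` with `D a ∩ D b ≠ {0}` for all nonzero `a`, `b`. -/
def IsLeftOreDomain (D : Type*) [Ring D] : Prop :=
  IsDomain D ∧ ∀ a b : D, a ≠ 0 → b ≠ 0 → ∃ x y : D, x * a = y * b ∧ x * a ≠ 0

/-- A domain `D` with `a D ∩ b D ≠ {0}` for all nonzero `a`, `b`. -/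
def IsRightOreDomain (D : Type*) [Ring D] : Prop :=
  IsDomain D ∧ ∀ a b : D, a ≠ 0 → b ≠ 0 → ∃ x y : D, a * x = b * y ∧ a * x ≠ 0

/-- `ι : D → L` makes `L` a classical left ring of quotients of the domain `D`: it embeds `D`,
nonzero elements of `D` become invertible, and every element of `L` has the form `a⁻¹ b`. -/
structure IsClassicalLeftQuotientRing {D L : Type*} [Ring D] [DivisionRing L] (ι : D →+* L) :
    Prop where
  injective : Function.Injective ι
  isUnit : ∀ a : D, a ≠ 0 → IsUnit (ι a)
  exists_eq : ∀ x : L, ∃ a b : D, a ≠ 0 ∧ x = (ι a)⁻¹ * ι b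

/-- The right-handed version: every element of `L` has the form `b a⁻¹`. -/
structure IsClassicalRightQuotientRing {D L : Type*} [Ring D] [DivisionRing L] (ι : D →+* L) :
    Prop where
  injective : Function.Injective ι
  isUnit : ∀ a : D, a ≠ 0 → IsUnit (ι a)
  exists_eq : ∀ x : L, ∃ a b : D, a ≠ 0 ∧ x = ι b * (ι a)⁻¹

/-! On a symmetric slice domain, regular functions are the same thing as stem functions: holomorphic
maps `P` from the slice at `i` to the complexified quaternions `ℍ[ℂ]` with `P (star z) = coeffConj
(P z)`. The function induced by `P` takes at `x + I y` the value obtained from `P (x + iy)` by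
replacing the complex unit with `I`, acting from the left (`sliceEval`). The splitting of `f` on one
slice produces `P`, and the identity principle from the real points carries the formula to every
other slice (`exists_stem`).

Under this correspondence the `*`-product becomes the pointwise product of `ℍ[ℂ]`, the regular
conjugate becomes the complex-linear quaternionic conjugation, and `f^s` becomes the scalar function
`N(P)`, the sum of the squares of the four coefficients (`HasStem.starMul`, `HasStem.regConj`). The
ring axioms are therefore inherited from `ℍ[ℂ]`. The algebra `ℍ[ℂ]` has zero divisors, but `N` is
multiplicative and `N(P)` is holomorphic on a domain. If `N(P)` vanishes then `P` vanishes at the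
real points, where its coefficients are real and `N` is positive definite, hence everywhere. So
there are no zero divisors.

Each `f * f^c` is central, and nonzero when `f` is. The Ore conditions, the ring of fractions, and
its description by left and by right fractions then follow by pure algebra, because every fraction
can be given a central denominator.

It remains to compare the abstract fractions with the functions `f^{-*} * g`. Removing the zeros of
`N(P)` leaves a symmetric slice domain (`isPreconnected_ne_zero`). Two quotients agree on their
common domain exactly when the fractions agree (`IsStarRing.starQuotient_eq_iff`), and sums and
products of quotients, with their domains, are quotients over the denominator `f * f^c * (f' *
f'^c)`. -/

namespace SliceRegular

/-! ### Splitting the quaternions along a slice, and evaluating complex quaternions at an imaginary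
unit -/

section Algebra

/-- The imaginary unit `i` of the quaternions. -/
def unitI : ℍ[ℝ] := ⟨0, 1, 0, 0⟩
/-- The imaginary unit `j` of the quaternions. -/
def unitJ : ℍ[ℝ] := ⟨0, 0, 1, 0⟩
/-- The imaginary unit `k` of the quaternions. -/
def unitK : ℍ[ℝ] := ⟨0, 0, 0, 1⟩

@[simp] theorem unitI_re : unitI.re = 0 := rfl
@[simp] theorem unitI_imI : unitI.imI = 1 := rfl
@[simp] theorem unitI_imJ : unitI.imJ = 0 := rfl
@[simp] theorem unitI_imK : unitI.imK = 0 := rfl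
@[simp] theorem unitJ_re : unitJ.re = 0 := rfl
@[simp] theorem unitJ_imI : unitJ.imI = 0 := rfl
@[simp] theorem unitJ_imJ : unitJ.imJ = 1 := rfl
@[simp] theorem unitJ_imK : unitJ.imK = 0 := rfl
@[simp] theorem unitK_re : unitK.re = 0 := rfl
@[simp] theorem unitK_imI : unitK.imI = 0 := rfl
@[simp] theorem unitK_imJ : unitK.imJ = 0 := rfl
@[simp] theorem unitK_imK : unitK.imK = 1 := rfl

theorem mem_imagUnits_iff {I : ℍ[ℝ]} :
    I ∈ imagUnits ↔ I.re = 0 ∧ I.imI ^ 2 + I.imJ ^ 2 + I.imK ^ 2 = 1 := by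
  simp only [imagUnits, Set.mem_ofPred_eq, sq, Quaternion.ext_iff, Quaternion.re_mul,
    Quaternion.imI_mul, Quaternion.imJ_mul, Quaternion.imK_mul, Quaternion.re_neg,
    Quaternion.imI_neg, Quaternion.imJ_neg, Quaternion.imK_neg, Quaternion.re_one,
    Quaternion.imI_one, Quaternion.imJ_one, Quaternion.imK_one]
  constructor
  · rintro ⟨h0, h1, h2, h3⟩
    -- The vector part of `I * I` is twice the real part times the vector part. A nonzero real part
    -- would thus leave a real number with square `-1`.
    have hre : I.re = 0 := by
      by_contra hne
      have e1 : I.imI = 0 := by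
        have : I.re * I.imI = 0 := by linarith
        exact (mul_eq_zero.1 this).resolve_left hne
      have e2 : I.imJ = 0 := by
        have : I.re * I.imJ = 0 := by linarith
        exact (mul_eq_zero.1 this).resolve_left hne
      have e3 : I.imK = 0 := by
        have : I.re * I.imK = 0 := by linarith
        exact (mul_eq_zero.1 this).resolve_left hne
      rw [e1, e2, e3] at h0
      nlinarith [mul_self_nonneg I.re]
    rw [hre] at h0
    exact ⟨hre, by linarith⟩
  · rintro ⟨h0, h1⟩
    rw [h0]
    refine ⟨by linarith, by ring, by ring, by ring⟩

theorem imagUnits_mul_self {I : ℍ[ℝ]} (hI : I ∈ imagUnits) : I * I = -1 := by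
  rw [← sq]; exact hI

theorem unitI_mem : unitI ∈ imagUnits := by simp [mem_imagUnits_iff]

theorem neg_mem_imagUnits {I : ℍ[ℝ]} (hI : I ∈ imagUnits) : -I ∈ imagUnits := by
  simpa [imagUnits] using hI

theorem exists_orthogonal {I : ℍ[ℝ]} (hI : I ∈ imagUnits) :
    ∃ J ∈ imagUnits, inner ℝ I J = 0 := by
  obtain ⟨h0, h1⟩ := mem_imagUnits_iff.1 hI
  by_cases h : I.imI ^ 2 + I.imJ ^ 2 = 0
  · refine ⟨unitI, unitI_mem, ?_⟩
    have : I.imI = 0 := by nlinarith [sq_nonneg I.imI, sq_nonneg I.imJ]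
    simp [Quaternion.inner_def, this]
  · have hpos : 0 < I.imI ^ 2 + I.imJ ^ 2 := lt_of_le_of_ne (by positivity) (Ne.symm h)
    -- A quarter turn of the `(i, j)`-component of `I`, normalized. The excluded case is `I = ±k`,
    -- where `i` itself is orthogonal.
    refine ⟨(√(I.imI ^ 2 + I.imJ ^ 2))⁻¹ • (I.imI • unitJ - I.imJ • unitI), ?_, ?_⟩
    · rw [mem_imagUnits_iff]
      simp only [Quaternion.re_smul, Quaternion.re_sub, unitJ_re, unitI_re,
        Quaternion.imI_smul, Quaternion.imJ_smul, Quaternion.imK_smul, Quaternion.imI_sub,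
        Quaternion.imJ_sub, Quaternion.imK_sub, unitI_imI, unitJ_imI, unitI_imJ, unitJ_imJ,
        unitI_imK, unitJ_imK, smul_eq_mul, mul_pow, inv_pow, Real.sq_sqrt hpos.le]
      refine ⟨by ring, ?_⟩
      field_simp
      ring
    · simp only [Quaternion.inner_def, Quaternion.re_mul, Quaternion.re_star, Quaternion.imI_star,
        Quaternion.imJ_star, Quaternion.imK_star, Quaternion.re_smul, Quaternion.re_sub, unitJ_re,
        unitI_re, Quaternion.imI_smul, Quaternion.imJ_smul, Quaternion.imK_smul, Quaternion.imI_sub,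
        Quaternion.imJ_sub, Quaternion.imK_sub, unitI_imI, unitJ_imI, unitI_imJ, unitJ_imJ,
        unitI_imK, unitJ_imK, smul_eq_mul]
      ring

theorem sliceMap_re (I : ℍ[ℝ]) (z : ℂ) : (sliceMap I z).re = z.re + I.re * z.im := by
  simp [sliceMap]
theorem sliceMap_imI (I : ℍ[ℝ]) (z : ℂ) : (sliceMap I z).imI = I.imI * z.im := by
  simp [sliceMap]
theorem sliceMap_imJ (I : ℍ[ℝ]) (z : ℂ) : (sliceMap I z).imJ = I.imJ * z.im := by
  simp [sliceMap]
theorem sliceMap_imK (I : ℍ[ℝ]) (z : ℂ) : (sliceMap I z).imK = I.imK * z.im := by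
  simp [sliceMap]

theorem sliceMap_ofReal (I : ℍ[ℝ]) (r : ℝ) : sliceMap I r = r := by
  simp [sliceMap]

theorem sliceMap_zero (I : ℍ[ℝ]) : sliceMap I 0 = 0 := by simp [sliceMap]

theorem sliceMap_one (I : ℍ[ℝ]) : sliceMap I 1 = 1 := by simp [sliceMap]

theorem sliceMap_add (I : ℍ[ℝ]) (z w : ℂ) : sliceMap I (z + w) = sliceMap I z + sliceMap I w := by
  simp only [sliceMap, Complex.add_re, Complex.add_im, Quaternion.coe_add, mul_add]
  abel

theorem sliceMap_smul (I : ℍ[ℝ]) (r : ℝ) (z : ℂ) : sliceMap I (r • z) = r • sliceMap I z := by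
  ext <;> simp only [Quaternion.re_smul, Quaternion.imI_smul, Quaternion.imJ_smul,
    Quaternion.imK_smul, sliceMap_re, sliceMap_imI, sliceMap_imJ, sliceMap_imK, Complex.smul_re,
    Complex.smul_im, smul_eq_mul] <;> ring

theorem sliceMap_neg (I : ℍ[ℝ]) (z : ℂ) : sliceMap I (-z) = -sliceMap I z := by
  simpa using sliceMap_smul I (-1) z

theorem sliceMap_sub (I : ℍ[ℝ]) (z w : ℂ) : sliceMap I (z - w) = sliceMap I z - sliceMap I w := by
  rw [sub_eq_add_neg, sliceMap_add, sliceMap_neg, ← sub_eq_add_neg]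

theorem sliceMap_mul {I : ℍ[ℝ]} (hI : I ∈ imagUnits) (z w : ℂ) :
    sliceMap I (z * w) = sliceMap I z * sliceMap I w := by
  obtain ⟨h0, h1⟩ := mem_imagUnits_iff.1 hI
  ext <;> simp only [Quaternion.re_mul, Quaternion.imI_mul, Quaternion.imJ_mul,
    Quaternion.imK_mul, sliceMap_re, sliceMap_imI, sliceMap_imJ, sliceMap_imK, h0, Complex.mul_re,
    Complex.mul_im]
  · linear_combination (z.im * w.im) * h1
  all_goals ring

theorem sliceMap_I (I : ℍ[ℝ]) : sliceMap I Complex.I = I := by simp [sliceMap]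

theorem sliceMap_neg_left (I : ℍ[ℝ]) (z : ℂ) : sliceMap (-I) z = sliceMap I (star z) := by
  simp [sliceMap]

theorem star_sliceMap {I : ℍ[ℝ]} (hI : I ∈ imagUnits) (z : ℂ) :
    star (sliceMap I z) = sliceMap I (star z) := by
  obtain ⟨h0, -⟩ := mem_imagUnits_iff.1 hI
  ext <;> simp [sliceMap_re, sliceMap_imI, sliceMap_imJ, sliceMap_imK, h0]

/-- The projection of the quaternions onto `ℝ + I ℝ`, in the coordinate of `ℝ + I ℝ`. -/
noncomputable def sliceProj (I q : ℍ[ℝ]) : ℂ := ⟨q.re, -(I * q).re⟩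

theorem sliceProj_add (I q r : ℍ[ℝ]) : sliceProj I (q + r) = sliceProj I q + sliceProj I r := by
  apply Complex.ext
  · simp [sliceProj]
  · simp [sliceProj, mul_add, -Quaternion.re_mul]; ring

/-- The projection is complex linear for the complex structure given by left multiplication with
`I`. This is what turns Cauchy–Riemann equations in the quaternions into ordinary holomorphy. -/
theorem sliceProj_mul {I : ℍ[ℝ]} (hI : I ∈ imagUnits) (z : ℂ) (q : ℍ[ℝ]) :
    sliceProj I (sliceMap I z * q) = z * sliceProj I q := by
  obtain ⟨h0, h1⟩ := mem_imagUnits_iff.1 hI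
  apply Complex.ext
  · simp only [sliceProj, Quaternion.re_mul, Complex.mul_re, sliceMap_re, sliceMap_imI,
      sliceMap_imJ, sliceMap_imK, h0]
    ring
  · simp only [sliceProj, Quaternion.re_mul, Complex.mul_im, Quaternion.imI_mul,
      Quaternion.imJ_mul, Quaternion.imK_mul, sliceMap_re, sliceMap_imI,
      sliceMap_imJ, sliceMap_imK, h0]
    linear_combination (z.im * q.re) * h1

theorem sliceProj_sliceMap {I : ℍ[ℝ]} (hI : I ∈ imagUnits) (z : ℂ) :
    sliceProj I (sliceMap I z) = z := by
  have : sliceProj I 1 = 1 := by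
    apply Complex.ext <;> simp [sliceProj, (mem_imagUnits_iff.1 hI).1]
  simpa [this] using sliceProj_mul hI z 1

theorem sliceProj_orthogonal {I J : ℍ[ℝ]} (hI : I ∈ imagUnits) (hJ : J ∈ imagUnits)
    (hIJ : inner ℝ I J = 0) : sliceProj I J = 0 := by
  have h0 := (mem_imagUnits_iff.1 hI).1
  have h1 := (mem_imagUnits_iff.1 hJ).1
  rw [Quaternion.inner_def] at hIJ
  simp only [Quaternion.re_mul, Quaternion.re_star, Quaternion.imI_star,
        Quaternion.imJ_star, Quaternion.imK_star, h0, h1] at hIJ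
  apply Complex.ext
  · simp [sliceProj, h1]
  · simp only [sliceProj, Quaternion.re_mul, h0, h1, Complex.zero_im]
    linarith

/-- Orthogonal imaginary units anticommute, since `I J + J I = -2 ⟨I, J⟩`; so `J` conjugates `ℝ + I
ℝ`. -/
theorem mul_sliceMap_orthogonal {I J : ℍ[ℝ]} (hI : I ∈ imagUnits) (hJ : J ∈ imagUnits)
    (hIJ : inner ℝ I J = 0) (z : ℂ) : J * sliceMap I z = sliceMap I (star z) * J := by
  have h0 := (mem_imagUnits_iff.1 hI).1
  have h1 := (mem_imagUnits_iff.1 hJ).1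
  rw [Quaternion.inner_def] at hIJ
  simp only [Quaternion.re_mul, Quaternion.re_star, Quaternion.imI_star,
        Quaternion.imJ_star, Quaternion.imK_star, h0, h1] at hIJ
  ext <;> simp only [Quaternion.re_mul, Quaternion.imI_mul, Quaternion.imJ_mul,
    Quaternion.imK_mul, sliceMap_re, sliceMap_imI, sliceMap_imJ, sliceMap_imK, h0, h1,
    Complex.star_def, Complex.conj_re, Complex.conj_im]
  · linear_combination (-2 * z.im) * hIJ
  all_goals ring

/-- The coefficient of `J` in the decomposition of a quaternion along `ℝ + I ℝ` and
`(ℝ + I ℝ) J`. -/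
noncomputable def sliceCoproj (I J q : ℍ[ℝ]) : ℂ := sliceProj I (-(q * J))

theorem sliceProj_decomp {I J : ℍ[ℝ]} (hI : I ∈ imagUnits) (hJ : J ∈ imagUnits)
    (hIJ : inner ℝ I J = 0) (a b : ℂ) :
    sliceProj I (sliceMap I a + sliceMap I b * J) = a := by
  rw [sliceProj_add, sliceProj_sliceMap hI, sliceProj_mul hI, sliceProj_orthogonal hI hJ hIJ,
    mul_zero, add_zero]

/-- Right multiplication by `-J` sends `a + b J` to `b - a J`, bringing the second coefficient into
first place. -/
theorem sliceCoproj_decomp {I J : ℍ[ℝ]} (hI : I ∈ imagUnits) (hJ : J ∈ imagUnits)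
    (hIJ : inner ℝ I J = 0) (a b : ℂ) :
    sliceCoproj I J (sliceMap I a + sliceMap I b * J) = b := by
  have : -((sliceMap I a + sliceMap I b * J) * J) = sliceMap I b + sliceMap I (-a) * J := by
    rw [add_mul, mul_assoc, imagUnits_mul_self hJ, sliceMap_neg]
    simp
  rw [sliceCoproj, this, sliceProj_decomp hI hJ hIJ]

/-- The map `(a, b) ↦ a + b J` is injective because the two projections recover `a` and `b`; both
sides have real dimension four, so it is onto. -/
theorem decomp {I J : ℍ[ℝ]} (hI : I ∈ imagUnits) (hJ : J ∈ imagUnits)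
    (hIJ : inner ℝ I J = 0) (q : ℍ[ℝ]) :
    sliceMap I (sliceProj I q) + sliceMap I (sliceCoproj I J q) * J = q := by
  let T : ℂ × ℂ →ₗ[ℝ] ℍ[ℝ] :=
    { toFun := fun p => sliceMap I p.1 + sliceMap I p.2 * J
      map_add' := fun p r => by simp only [Prod.fst_add, Prod.snd_add, sliceMap_add, add_mul]; abel
      map_smul' := fun c p => by
        simp only [Prod.smul_fst, Prod.smul_snd, sliceMap_smul, smul_add, smul_mul_assoc,
          RingHom.id_apply] }
  have hinj : Function.Injective T := fun p r h => by
    have h1 := congrArg (sliceProj I) h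
    have h2 := congrArg (sliceCoproj I J) h
    simp only [T, LinearMap.coe_mk, AddHom.coe_mk, sliceProj_decomp hI hJ hIJ,
      sliceCoproj_decomp hI hJ hIJ] at h1 h2
    exact Prod.ext h1 h2
  have hfin : Module.finrank ℝ (ℂ × ℂ) = Module.finrank ℝ ℍ[ℝ] := by
    rw [Module.finrank_prod, Complex.finrank_real_complex, Quaternion.finrank_eq_four]
  obtain ⟨⟨a, b⟩, hab⟩ :=
    (LinearMap.injective_iff_surjective_of_finrank_eq_finrank hfin).1 hinj q
  simp only [T, LinearMap.coe_mk, AddHom.coe_mk] at hab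
  rw [← hab, sliceProj_decomp hI hJ hIJ, sliceCoproj_decomp hI hJ hIJ]

/-- The Cayley–Dickson multiplication rule, which comes from `J z = z̄ J` and `J² = -1`. -/
theorem sliceProj_mul_eq {I J : ℍ[ℝ]} (hI : I ∈ imagUnits) (hJ : J ∈ imagUnits)
    (hIJ : inner ℝ I J = 0) (q r : ℍ[ℝ]) :
    sliceProj I (q * r) = sliceProj I q * sliceProj I r -
        sliceCoproj I J q * star (sliceCoproj I J r) ∧
      sliceCoproj I J (q * r) = sliceProj I q * sliceCoproj I J r +
        sliceCoproj I J q * star (sliceProj I r) := by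
  generalize ha : sliceProj I q = a
  generalize hb : sliceCoproj I J q = b
  generalize hc : sliceProj I r = c
  generalize hd : sliceCoproj I J r = d
  have key : q * r =
      sliceMap I (a * c - b * star d) + sliceMap I (a * d + b * star c) * J := by
    rw [← decomp hI hJ hIJ q, ← decomp hI hJ hIJ r, ha, hb, hc, hd]
    have e1 : sliceMap I b * J * sliceMap I c = sliceMap I (b * star c) * J := by
      rw [mul_assoc, mul_sliceMap_orthogonal hI hJ hIJ, ← mul_assoc, sliceMap_mul hI]
    have e2 : sliceMap I b * J * (sliceMap I d * J) = -sliceMap I (b * star d) := by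
      rw [mul_assoc, ← mul_assoc J, mul_sliceMap_orthogonal hI hJ hIJ, mul_assoc _ J,
        imagUnits_mul_self hJ, sliceMap_mul hI]
      simp
    rw [add_mul, mul_add, mul_add, e1, e2, sliceMap_sub, sliceMap_add, sliceMap_mul hI a,
      sliceMap_mul hI a, add_mul, mul_assoc]
    abel
  rw [key, sliceProj_decomp hI hJ hIJ, sliceCoproj_decomp hI hJ hIJ]
  exact ⟨rfl, rfl⟩

theorem sliceProj_star_eq {I J : ℍ[ℝ]} (hI : I ∈ imagUnits) (hJ : J ∈ imagUnits)
    (hIJ : inner ℝ I J = 0) (q : ℍ[ℝ]) :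
    sliceProj I (star q) = star (sliceProj I q) ∧
      sliceCoproj I J (star q) = -sliceCoproj I J q := by
  generalize ha : sliceProj I q = a
  generalize hb : sliceCoproj I J q = b
  have key : star q = sliceMap I (star a) + sliceMap I (-b) * J := by
    have hJs : star J = -J := by
      rw [Quaternion.star_eq_neg, (mem_imagUnits_iff.1 hJ).1]
    rw [← decomp hI hJ hIJ q, ha, hb, star_add, star_mul, star_sliceMap hI, star_sliceMap hI, hJs,
      neg_mul, mul_sliceMap_orthogonal hI hJ hIJ, star_star, sliceMap_neg, neg_mul]
  rw [key, sliceProj_decomp hI hJ hIJ, sliceCoproj_decomp hI hJ hIJ]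
  exact ⟨rfl, rfl⟩

/-- The evaluation `ℍ ⊗ ℂ → ℍ`, `h ⊗ z ↦ (x + I y) h` at the imaginary unit `I`. -/
noncomputable def sliceEval (I : ℍ[ℝ]) (p : ℍ[ℂ]) : ℍ[ℝ] :=
  sliceMap I p.re + sliceMap I p.imI * unitI + sliceMap I p.imJ * unitJ + sliceMap I p.imK * unitK

/-- The complex conjugation of the coefficients of a complex quaternion. -/
noncomputable def coeffConj (p : ℍ[ℂ]) : ℍ[ℂ] := ⟨star p.re, star p.imI, star p.imJ, star p.imK⟩

@[simp] theorem coeffConj_re (p : ℍ[ℂ]) : (coeffConj p).re = star p.re := rfl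
@[simp] theorem coeffConj_imI (p : ℍ[ℂ]) : (coeffConj p).imI = star p.imI := rfl
@[simp] theorem coeffConj_imJ (p : ℍ[ℂ]) : (coeffConj p).imJ = star p.imJ := rfl
@[simp] theorem coeffConj_imK (p : ℍ[ℂ]) : (coeffConj p).imK = star p.imK := rfl

theorem sliceEval_neg_left (I : ℍ[ℝ]) (p : ℍ[ℂ]) :
    sliceEval (-I) p = sliceEval I (coeffConj p) := by
  simp only [sliceEval, sliceMap_neg_left, coeffConj_re, coeffConj_imI, coeffConj_imJ,
    coeffConj_imK]

theorem sliceEval_add (I : ℍ[ℝ]) (p q : ℍ[ℂ]) :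
    sliceEval I (p + q) = sliceEval I p + sliceEval I q := by
  simp only [sliceEval, Quaternion.re_add, Quaternion.imI_add, Quaternion.imJ_add,
    Quaternion.imK_add, sliceMap_add, add_mul]
  abel

theorem sliceEval_smul {I : ℍ[ℝ]} (hI : I ∈ imagUnits) (z : ℂ) (p : ℍ[ℂ]) :
    sliceEval I (z • p) = sliceMap I z * sliceEval I p := by
  simp only [sliceEval, Quaternion.re_smul, Quaternion.imI_smul, Quaternion.imJ_smul,
    Quaternion.imK_smul, smul_eq_mul, sliceMap_mul hI, mul_add, mul_assoc]

theorem sliceEval_coe (I : ℍ[ℝ]) (z : ℂ) : sliceEval I (z : ℍ[ℂ]) = sliceMap I z := by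
  simp [sliceEval, sliceMap_zero]

theorem sliceEval_eq_of_real (I J : ℍ[ℝ]) {p : ℍ[ℂ]} (hp : coeffConj p = p) :
    sliceEval I p = sliceEval J p := by
  have h : ∀ w : ℂ, star w = w → sliceMap I w = sliceMap J w := fun w hw => by
    rw [← Complex.conj_eq_iff_real.1 hw |>.choose_spec.symm]
    simp [sliceMap_ofReal]
  rw [Quaternion.ext_iff] at hp
  simp only [sliceEval]
  rw [h _ hp.1, h _ hp.2.1, h _ hp.2.2.1, h _ hp.2.2.2]

/-- If `p` has real part `A` and imaginary part `B` in `ℍ`, the two values are `A + iB` and `A -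
iB`, which determine `A` and `B`. One unit alone would not suffice. -/
theorem sliceEval_ext {p q : ℍ[ℂ]} (h : sliceEval unitI p = sliceEval unitI q)
    (h' : sliceEval (-unitI) p = sliceEval (-unitI) q) : p = q := by
  rw [Quaternion.ext_iff] at h h'
  simp only [sliceEval, Quaternion.re_add, Quaternion.imI_add, Quaternion.imJ_add,
    Quaternion.imK_add, Quaternion.re_mul, Quaternion.imI_mul, Quaternion.imJ_mul,
    Quaternion.imK_mul, sliceMap_re, sliceMap_imI, sliceMap_imJ, sliceMap_imK, Quaternion.re_neg,
    Quaternion.imI_neg, Quaternion.imJ_neg, Quaternion.imK_neg, unitI_re, unitI_imI, unitI_imJ,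
    unitI_imK, unitJ_re, unitJ_imI, unitJ_imJ, unitJ_imK, unitK_re, unitK_imI, unitK_imJ,
    unitK_imK] at h h'
  obtain ⟨h1, h2, h3, h4⟩ := h
  obtain ⟨k1, k2, k3, k4⟩ := h'
  ext <;> apply Complex.ext <;> linarith

/-- The projection of `sliceEval I p` onto `ℝ + I ℝ`. -/
noncomputable def evalProj (I : ℍ[ℝ]) (p : ℍ[ℂ]) : ℂ :=
  p.re * sliceProj I 1 + p.imI * sliceProj I unitI + p.imJ * sliceProj I unitJ +
    p.imK * sliceProj I unitK

/-- The coefficient of `J` of `sliceEval I p`. -/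
noncomputable def evalCoproj (I J : ℍ[ℝ]) (p : ℍ[ℂ]) : ℂ :=
  p.re * sliceCoproj I J 1 + p.imI * sliceCoproj I J unitI + p.imJ * sliceCoproj I J unitJ +
    p.imK * sliceCoproj I J unitK

theorem sliceProj_sliceEval {I : ℍ[ℝ]} (hI : I ∈ imagUnits) (p : ℍ[ℂ]) :
    sliceProj I (sliceEval I p) = evalProj I p := by
  have h : sliceMap I p.re = sliceMap I p.re * 1 := (mul_one _).symm
  rw [sliceEval, h]
  simp only [sliceProj_add, sliceProj_mul hI, evalProj]

theorem sliceCoproj_sliceEval {I : ℍ[ℝ]} (hI : I ∈ imagUnits) (J : ℍ[ℝ]) (p : ℍ[ℂ]) :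
    sliceCoproj I J (sliceEval I p) = evalCoproj I J p := by
  have h : sliceMap I p.re = sliceMap I p.re * 1 := (mul_one _).symm
  rw [sliceEval, h]
  simp only [sliceCoproj, add_mul, neg_add, sliceProj_add, mul_assoc, ← mul_neg,
    sliceProj_mul hI, evalCoproj]

theorem sliceEval_decomp {I J : ℍ[ℝ]} (hI : I ∈ imagUnits) (hJ : J ∈ imagUnits)
    (hIJ : inner ℝ I J = 0) (p : ℍ[ℂ]) :
    sliceEval I p = sliceMap I (evalProj I p) + sliceMap I (evalCoproj I J p) * J := by
  rw [← sliceProj_sliceEval hI, ← sliceCoproj_sliceEval hI, decomp hI hJ hIJ]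

theorem sliceProj_one {I : ℍ[ℝ]} (hI : I ∈ imagUnits) : sliceProj I 1 = 1 := by
  simpa [sliceMap_one] using sliceProj_sliceMap hI 1

theorem sliceCoproj_one {I J : ℍ[ℝ]} (hI : I ∈ imagUnits) (hJ : J ∈ imagUnits)
    (hIJ : inner ℝ I J = 0) : sliceCoproj I J 1 = 0 := by
  simpa [sliceMap_one, sliceMap_zero] using sliceCoproj_decomp hI hJ hIJ 1 0

theorem unitI_mul_unitI : unitI * unitI = -1 := by ext <;> simp
theorem unitJ_mul_unitJ : unitJ * unitJ = -1 := by ext <;> simp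
theorem unitK_mul_unitK : unitK * unitK = -1 := by ext <;> simp
theorem unitI_mul_unitJ : unitI * unitJ = unitK := by ext <;> simp
theorem unitJ_mul_unitI : unitJ * unitI = -unitK := by ext <;> simp
theorem unitJ_mul_unitK : unitJ * unitK = unitI := by ext <;> simp
theorem unitK_mul_unitJ : unitK * unitJ = -unitI := by ext <;> simp
theorem unitK_mul_unitI : unitK * unitI = unitJ := by ext <;> simp
theorem unitI_mul_unitK : unitI * unitK = -unitJ := by ext <;> simp

theorem sliceProj_neg (I q : ℍ[ℝ]) : sliceProj I (-q) = -sliceProj I q := by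
  apply Complex.ext <;> simp [sliceProj, -Quaternion.re_mul]

theorem sliceCoproj_neg (I J q : ℍ[ℝ]) : sliceCoproj I J (-q) = -sliceCoproj I J q := by
  simp only [sliceCoproj, neg_mul, sliceProj_neg]

/-- The source of the `*`-product formula: for a stem `Q`, `coeffConj (Q z)` is `Q (star z)`. The
outer `star` and the inner `coeffConj` cancel on the coefficients of `q`, so both sides are complex
bilinear in `(p, q)`. It is enough to compare products of the basis units, which is the
Cayley–Dickson rule for `i`, `j`, `k`. -/
theorem evalProj_mul {I J : ℍ[ℝ]} (hI : I ∈ imagUnits) (hJ : J ∈ imagUnits)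
    (hIJ : inner ℝ I J = 0) (p q : ℍ[ℂ]) :
    evalProj I (p * q) = evalProj I p * evalProj I q -
        evalCoproj I J p * star (evalCoproj I J (coeffConj q)) ∧
      evalCoproj I J (p * q) = evalProj I p * evalCoproj I J q +
        evalCoproj I J p * star (evalProj I (coeffConj q)) := by
  have hmul := sliceProj_mul_eq hI hJ hIJ
  have ii := hmul unitI unitI
  have ij := hmul unitI unitJ
  have ik := hmul unitI unitK
  have ji := hmul unitJ unitI
  have jj := hmul unitJ unitJ
  have jk := hmul unitJ unitK
  have ki := hmul unitK unitI
  have kj := hmul unitK unitJ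
  have kk := hmul unitK unitK
  rw [unitI_mul_unitI, sliceProj_neg, sliceCoproj_neg, sliceProj_one hI,
    sliceCoproj_one hI hJ hIJ] at ii
  rw [unitJ_mul_unitJ, sliceProj_neg, sliceCoproj_neg, sliceProj_one hI,
    sliceCoproj_one hI hJ hIJ] at jj
  rw [unitK_mul_unitK, sliceProj_neg, sliceCoproj_neg, sliceProj_one hI,
    sliceCoproj_one hI hJ hIJ] at kk
  rw [unitI_mul_unitJ] at ij
  rw [unitJ_mul_unitK] at jk
  rw [unitK_mul_unitI] at ki
  rw [unitJ_mul_unitI, sliceProj_neg, sliceCoproj_neg] at ji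
  rw [unitK_mul_unitJ, sliceProj_neg, sliceCoproj_neg] at kj
  rw [unitI_mul_unitK, sliceProj_neg, sliceCoproj_neg] at ik
  simp only [evalProj, evalCoproj, sliceProj_one hI, sliceCoproj_one hI hJ hIJ, Quaternion.re_mul,
    Quaternion.imI_mul, Quaternion.imJ_mul, Quaternion.imK_mul, coeffConj_re, coeffConj_imI,
    coeffConj_imJ, coeffConj_imK, star_add, star_mul', star_star, star_one, star_zero]
  constructor
  · linear_combination p.imI * q.imI * ii.1 + p.imI * q.imJ * ij.1 + p.imI * q.imK * ik.1 +
      p.imJ * q.imI * ji.1 + p.imJ * q.imJ * jj.1 + p.imJ * q.imK * jk.1 +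
      p.imK * q.imI * ki.1 + p.imK * q.imJ * kj.1 + p.imK * q.imK * kk.1
  · linear_combination p.imI * q.imI * ii.2 + p.imI * q.imJ * ij.2 + p.imI * q.imK * ik.2 +
      p.imJ * q.imI * ji.2 + p.imJ * q.imJ * jj.2 + p.imJ * q.imK * jk.2 +
      p.imK * q.imI * ki.2 + p.imK * q.imJ * kj.2 + p.imK * q.imK * kk.2

theorem evalProj_star {I J : ℍ[ℝ]} (hI : I ∈ imagUnits) (hJ : J ∈ imagUnits)
    (hIJ : inner ℝ I J = 0) (p : ℍ[ℂ]) :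
    evalProj I (star p) = star (evalProj I (coeffConj p)) ∧
      evalCoproj I J (star p) = -evalCoproj I J p := by
  have hstar := sliceProj_star_eq hI hJ hIJ
  have i := hstar unitI
  have j := hstar unitJ
  have k := hstar unitK
  rw [show star unitI = -unitI by ext <;> simp, sliceProj_neg] at i
  rw [show star unitJ = -unitJ by ext <;> simp, sliceProj_neg] at j
  rw [show star unitK = -unitK by ext <;> simp, sliceProj_neg] at k
  simp only [evalProj, evalCoproj, sliceProj_one hI, sliceCoproj_one hI hJ hIJ, Quaternion.re_star,
    Quaternion.imI_star, Quaternion.imJ_star, Quaternion.imK_star, coeffConj_re, coeffConj_imI,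
    coeffConj_imJ, coeffConj_imK, star_add, star_mul', star_star, star_one]
  constructor
  · linear_combination p.imI * i.1 + p.imJ * j.1 + p.imK * k.1
  · ring

end Algebra


/-! ### Identity theorems and removal of zeros in one complex variable -/

section Identity

/-- A product of two holomorphic functions on a domain vanishes only if a factor does. -/
theorem eqOn_zero_or_eqOn_zero_of_mul {D : Set ℂ} (hD : IsOpen D) (hc : IsPreconnected D)
    {f g : ℂ → ℂ} (hf : DifferentiableOn ℂ f D) (hg : DifferentiableOn ℂ g D)
    (h : ∀ z ∈ D, f z * g z = 0) : Set.EqOn f 0 D ∨ Set.EqOn g 0 D := by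
  rcases (hf.analyticOnNhd hD).eqOn_zero_or_eventually_ne_zero_of_preconnected hc with h0 | h0
  · exact Or.inl h0
  rcases (hg.analyticOnNhd hD).eqOn_zero_or_eventually_ne_zero_of_preconnected hc with h1 | h1
  · exact Or.inr h1
  left
  intro z hz
  exfalso
  -- Neither function is identically zero, so the zeros of both are isolated in `D`, and close to
  -- `z` there is a point where neither vanishes.
  have h2 := h0.and h1
  rw [Filter.eventually_iff, mem_codiscreteWithin] at h2
  have h3 := h2 z hz
  rw [Filter.disjoint_principal_right] at h3
  have h4 : D ∈ nhdsWithin z {z}ᶜ := mem_nhdsWithin_of_mem_nhds (hD.mem_nhds hz)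
  obtain ⟨w, hw1, hw2⟩ := (Filter.nonempty_of_mem (Filter.inter_mem h3 h4))
  exact hw1 ⟨hw2, fun hw => mul_ne_zero hw.1 hw.2 (h w hw2)⟩

/-- A holomorphic function on a domain that vanishes at the real points vanishes. -/
theorem eqOn_zero_of_real {D : Set ℂ} (hD : IsOpen D) (hc : IsPreconnected D) {r : ℝ}
    (hr : (r : ℂ) ∈ D) {f : ℂ → ℂ} (hf : DifferentiableOn ℂ f D)
    (h : ∀ x : ℝ, (x : ℂ) ∈ D → f x = 0) : Set.EqOn f 0 D := by
  refine (hf.analyticOnNhd hD).eqOn_zero_of_preconnected_of_frequently_eq_zero hc hr ?_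
  have ht : Filter.Tendsto (fun x : ℝ => (x : ℂ)) (nhdsWithin r {r}ᶜ)
      (nhdsWithin (r : ℂ) {(r : ℂ)}ᶜ) := by
    refine tendsto_nhdsWithin_iff.2 ⟨?_, ?_⟩
    · exact (Complex.continuous_ofReal.tendsto r).mono_left nhdsWithin_le_nhds
    · filter_upwards [self_mem_nhdsWithin] with x hx
      simpa using hx
  refine ht.frequently (Filter.Eventually.frequently ?_)
  have : ∀ᶠ x : ℝ in nhds r, (x : ℂ) ∈ D :=
    Complex.continuous_ofReal.continuousAt.eventually (hD.mem_nhds hr)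
  filter_upwards [nhdsWithin_le_nhds this] with x hx using h x hx

/-- Removing the zeros of a holomorphic function from a domain leaves a connected set. -/
theorem isPreconnected_ne_zero {D : Set ℂ} (hD : IsOpen D) (hc : IsPreconnected D)
    {f : ℂ → ℂ} (hf : DifferentiableOn ℂ f D) : IsPreconnected {z | z ∈ D ∧ f z ≠ 0} := by
  classical
  rintro u v hu hv huv ⟨a, haT, hau⟩ ⟨b, hbT, hbv⟩
  by_contra hne
  rw [Set.not_nonempty_iff_eq_empty] at hne
  have hdisj : ∀ z, z ∈ D → f z ≠ 0 → z ∈ u → z ∉ v := fun z h1 h2 h3 h4 => by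
    have : z ∈ ({z | z ∈ D ∧ f z ≠ 0} ∩ (u ∩ v) : Set ℂ) := ⟨⟨h1, h2⟩, h3, h4⟩
    rw [hne] at this
    exact this
  -- If `s` is locally constant away from the zeros of `f`, then `f²` cut off to `s` is holomorphic
  -- on all of `D`. The square matters: at a zero `z` of `f` it is `o(w - z)`, so the cut-off
  -- function has derivative `0` there whatever `s` is.
  have hd : ∀ s : Set ℂ, (∀ z ∈ D, f z ≠ 0 → (∀ᶠ w in nhds z, w ∈ s) ∨ ∀ᶠ w in nhds z, w ∉ s) →
      DifferentiableOn ℂ (fun z => if z ∈ s then f z * f z else 0) D := by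
    intro s hs z hz
    apply DifferentiableAt.differentiableWithinAt
    have hfz := hf.differentiableAt (hD.mem_nhds hz)
    by_cases h0 : f z = 0
    · have hO : f =O[nhds z] fun w => w - z := by
        simpa [h0] using hfz.hasFDerivAt.isBigO_sub
      have ho : f =o[nhds z] fun _ => (1 : ℂ) := by
        rw [Asymptotics.isLittleO_one_iff, ← h0]
        exact hfz.continuousAt
      have hm : (fun w => if w ∈ s then f w * f w else 0) =o[nhds z] fun w => w - z := by
        have h1 : (fun w => f w * f w) =o[nhds z] fun w => w - z := by
          simpa using hO.mul_isLittleO ho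
        refine Asymptotics.IsBigO.trans_isLittleO (Asymptotics.IsBigO.of_bound 1 ?_) h1
        refine Filter.Eventually.of_forall fun w => ?_
        split_ifs <;> simp [mul_self_nonneg]
      refine (HasFDerivAt.of_isLittleO (f' := 0) ?_).differentiableAt
      simpa [h0] using hm
    · rcases hs z hz h0 with h1 | h1
      · refine (hfz.mul hfz).congr_of_eventuallyEq ?_
        filter_upwards [h1] with w hw
        simp [hw]
      · refine (differentiableAt_const (0 : ℂ)).congr_of_eventuallyEq ?_
        filter_upwards [h1] with w hw
        simp [hw]
  have hT : ∀ z ∈ D, f z ≠ 0 → {w | w ∈ D ∧ f w ≠ 0} ∈ nhds z := fun z hz h0 =>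
    Filter.inter_mem (hD.mem_nhds hz)
      ((hf.differentiableAt (hD.mem_nhds hz)).continuousAt.eventually_ne h0)
  have h1 : DifferentiableOn ℂ (fun z => if z ∈ u then f z * f z else 0) D := by
    refine hd u fun z hz h0 => ?_
    rcases huv ⟨hz, h0⟩ with h | h
    · exact Or.inl (hu.mem_nhds h)
    · right
      filter_upwards [hv.mem_nhds h, hT z hz h0] with w hw hw' hwu
      exact hdisj w hw'.1 hw'.2 hwu hw
  have h2 : DifferentiableOn ℂ (fun z => if z ∈ v then f z * f z else 0) D := by
    refine hd v fun z hz h0 => ?_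
    rcases huv ⟨hz, h0⟩ with h | h
    · right
      filter_upwards [hu.mem_nhds h, hT z hz h0] with w hw hw'
      exact hdisj w hw'.1 hw'.2 hw
    · exact Or.inl (hv.mem_nhds h)
  -- The cut-offs to `u` and to `v` have product zero, so one of them vanishes on `D`. This
  -- contradicts the point `a` or the point `b`.
  rcases eqOn_zero_or_eqOn_zero_of_mul hD hc h1 h2 (fun z hz => by
    by_cases h0 : f z = 0
    · simp [h0]
    · by_cases hzu : z ∈ u
      · simp [hdisj z hz h0 hzu]
      · simp [hzu]) with h | h
  · have := h haT.1
    simp only [if_pos hau, Pi.zero_apply] at this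
    exact mul_ne_zero haT.2 haT.2 this
  · have := h hbT.1
    simp only [if_pos hbv, Pi.zero_apply] at this
    exact mul_ne_zero hbT.2 hbT.2 this

end Identity

/-! ### Quaternion-valued functions holomorphic for left multiplication by `I` -/

section LeftHolomorphic

/-- Functions with values in the quaternions that are holomorphic for the complex structure
given by left multiplication with `I`. -/
def IsLeftHolomorphic (I : ℍ[ℝ]) (D : Set ℂ) (φ : ℂ → ℍ[ℝ]) : Prop :=
  ContDiffOn ℝ 1 φ D ∧ ∀ z ∈ D, dbar I φ z = 0

variable {I : ℍ[ℝ]} {D : Set ℂ} {φ ψ : ℂ → ℍ[ℝ]}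

theorem IsLeftHolomorphic.differentiableAt (hD : IsOpen D) (h : IsLeftHolomorphic I D φ)
    {z : ℂ} (hz : z ∈ D) : DifferentiableAt ℝ φ z :=
  (h.1.differentiableOn one_ne_zero).differentiableAt (hD.mem_nhds hz)

theorem IsLeftHolomorphic.congr (hD : IsOpen D) (h : IsLeftHolomorphic I D φ)
    (he : Set.EqOn ψ φ D) : IsLeftHolomorphic I D ψ := by
  refine ⟨h.1.congr he, fun z hz => ?_⟩
  have : ψ =ᶠ[nhds z] φ := by filter_upwards [hD.mem_nhds hz] with w hw using he hw
  have h2 := h.2 z hz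
  rwa [dbar, ← this.fderiv_eq] at h2

theorem IsLeftHolomorphic.add (hD : IsOpen D) (h : IsLeftHolomorphic I D φ)
    (h' : IsLeftHolomorphic I D ψ) : IsLeftHolomorphic I D (fun z => φ z + ψ z) := by
  refine ⟨h.1.add h'.1, fun z hz => ?_⟩
  have h1 := h.2 z hz
  have h2 := h'.2 z hz
  rw [dbar] at h1 h2 ⊢
  rw [fderiv_fun_add (h.differentiableAt hD hz) (h'.differentiableAt hD hz)]
  simp only [add_apply, mul_add]
  rw [← add_zero (0 : ℍ[ℝ])]
  nth_rewrite 1 [← h1]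
  rw [← h2, ← smul_add]
  congr 1
  abel

/-- `w ↦ (x + I y) e`, as a continuous real linear map. -/
noncomputable def sliceMapCLM (I e : ℍ[ℝ]) : ℂ →L[ℝ] ℍ[ℝ] :=
  LinearMap.toContinuousLinearMap
    { toFun := fun w => sliceMap I w * e
      map_add' := fun z w => by rw [sliceMap_add, add_mul]
      map_smul' := fun r z => by rw [sliceMap_smul, smul_mul_assoc, RingHom.id_apply] }

theorem sliceMapCLM_apply (I e : ℍ[ℝ]) (w : ℂ) : sliceMapCLM I e w = sliceMap I w * e := rfl

/-- The operator acts from the left, so the constant right factor `e` is harmless, and `F` satisfies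
the Cauchy–Riemann equation with `i` transported to `I`. -/
theorem isLeftHolomorphic_sliceMap (hI : I ∈ imagUnits) (hD : IsOpen D) {F : ℂ → ℂ}
    (hF : DifferentiableOn ℂ F D) (e : ℍ[ℝ]) :
    IsLeftHolomorphic I D (fun z => sliceMap I (F z) * e) := by
  constructor
  · exact (sliceMapCLM I e).contDiff.comp_contDiffOn ((hF.contDiffOn hD).restrict_scalars ℝ)
  · intro z hz
    have h1 := (hF.differentiableAt (hD.mem_nhds hz)).hasFDerivAt.restrictScalars ℝ
    have h2 : HasFDerivAt (fun z => sliceMap I (F z) * e) _ z :=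
      (sliceMapCLM I e).hasFDerivAt.comp z h1
    rw [dbar, h2.fderiv]
    simp only [ContinuousLinearMap.comp_apply, ContinuousLinearMap.coe_restrictScalars',
      sliceMapCLM_apply]
    have h3 : fderiv ℂ F z Complex.I = Complex.I * fderiv ℂ F z 1 := by
      rw [← smul_eq_mul, ← map_smul, smul_eq_mul, mul_one]
    rw [h3, sliceMap_mul hI, sliceMap_I, mul_assoc, ← mul_assoc I I, imagUnits_mul_self hI]
    simp

theorem isLeftHolomorphic_sliceEval (hI : I ∈ imagUnits) (hD : IsOpen D) {P : ℂ → ℍ[ℂ]}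
    (h0 : DifferentiableOn ℂ (fun z => (P z).re) D) (h1 : DifferentiableOn ℂ (fun z => (P z).imI) D)
    (h2 : DifferentiableOn ℂ (fun z => (P z).imJ) D)
    (h3 : DifferentiableOn ℂ (fun z => (P z).imK) D) :
    IsLeftHolomorphic I D (fun z => sliceEval I (P z)) := by
  have h := (((isLeftHolomorphic_sliceMap hI hD h0 1).add hD
    (isLeftHolomorphic_sliceMap hI hD h1 unitI)).add hD
    (isLeftHolomorphic_sliceMap hI hD h2 unitJ)).add hD (isLeftHolomorphic_sliceMap hI hD h3 unitK)
  simpa only [mul_one, sliceEval] using h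

/-- `q ↦ π_I (q c)` as a continuous real linear map. -/
noncomputable def sliceProjCLM (I c : ℍ[ℝ]) : ℍ[ℝ] →L[ℝ] ℂ :=
  LinearMap.toContinuousLinearMap
    { toFun := fun q => sliceProj I (q * c)
      map_add' := fun q r => by rw [add_mul, sliceProj_add]
      map_smul' := fun r q => by
        apply Complex.ext
        · simp [sliceProj, -Quaternion.re_mul]
        · simp [sliceProj, -Quaternion.re_mul] }

theorem sliceProjCLM_apply (I c q : ℍ[ℝ]) : sliceProjCLM I c q = sliceProj I (q * c) := rfl

/-- The equation reads `∂φ/∂y = I ∂φ/∂x`, and the projection turns `I` into `i`. The right factor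
`c` gives access to every coefficient: `c = 1` yields the first function of a splitting and `c = -J`
the second. -/
theorem IsLeftHolomorphic.differentiableOn_sliceProj (hI : I ∈ imagUnits) (hD : IsOpen D)
    (h : IsLeftHolomorphic I D φ) (c : ℍ[ℝ]) :
    DifferentiableOn ℂ (fun z => sliceProj I (φ z * c)) D := by
  intro z hz
  apply DifferentiableAt.differentiableWithinAt
  have hφ := h.differentiableAt hD hz
  have hcomp : HasFDerivAt (fun z => sliceProj I (φ z * c))
      ((sliceProjCLM I c).comp (fderiv ℝ φ z)) z :=
    (sliceProjCLM I c).hasFDerivAt.comp z hφ.hasFDerivAt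
  rw [differentiableAt_complex_iff_differentiableAt_real]
  refine ⟨hcomp.differentiableAt, ?_⟩
  rw [hcomp.fderiv]
  simp only [ContinuousLinearMap.comp_apply, sliceProjCLM_apply]
  have h2 := h.2 z hz
  rw [dbar, smul_eq_zero_iff_right (by norm_num)] at h2
  have h3 : fderiv ℝ φ z Complex.I = sliceMap I Complex.I * fderiv ℝ φ z 1 := by
    have h4 := congrArg (fun q => I * q) h2
    simp only [mul_add, mul_zero, ← mul_assoc, imagUnits_mul_self hI, neg_one_mul] at h4
    rw [sliceMap_I]
    exact (add_neg_eq_zero.1 h4).symm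
  rw [h3, mul_assoc, sliceProj_mul hI, smul_eq_mul]

/-- Identity principle: left holomorphic functions on a domain are determined by their values at
the real points. -/
theorem IsLeftHolomorphic.eqOn_of_real (hI : I ∈ imagUnits) (hD : IsOpen D)
    (hc : IsPreconnected D) {r : ℝ} (hr : (r : ℂ) ∈ D) (hφ : IsLeftHolomorphic I D φ)
    (hψ : IsLeftHolomorphic I D ψ) (h : ∀ x : ℝ, (x : ℂ) ∈ D → φ x = ψ x) :
    Set.EqOn φ ψ D := by
  intro z hz
  have key : ∀ c, sliceProj I (φ z * c) = sliceProj I (ψ z * c) := fun c => by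
    have := eqOn_zero_of_real hD hc hr
      ((hφ.differentiableOn_sliceProj hI hD c).sub (hψ.differentiableOn_sliceProj hI hD c))
      (fun x hx => by simp [h x hx]) hz
    exact sub_eq_zero.1 this
  -- With `c` the conjugate of the difference, the real part of the projection is the squared norm
  -- of the difference. This choice of `c` depends on `z`, which is allowed because `key` holds for
  -- all `c`.
  have h1 := congrArg Complex.re (key (star (φ z - ψ z)))
  simp only [sliceProj] at h1
  rw [← sub_eq_zero, ← Quaternion.re_sub, ← sub_mul, Quaternion.self_mul_star,
    Quaternion.re_coe, Quaternion.normSq_eq_zero, sub_eq_zero] at h1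
  exact h1

end LeftHolomorphic


/-! ### Representing quaternions on slices; symmetric slice domains from plane domains -/

section Slices

/-- Every quaternion lies on a slice. -/
theorem exists_sliceMap_eq (q : ℍ[ℝ]) : ∃ I ∈ imagUnits, ∃ z : ℂ, sliceMap I z = q := by
  by_cases h : q.imI ^ 2 + q.imJ ^ 2 + q.imK ^ 2 = 0
  · refine ⟨unitI, unitI_mem, q.re, ?_⟩
    have h1 : q.imI = 0 := by nlinarith [sq_nonneg q.imI, sq_nonneg q.imJ, sq_nonneg q.imK]
    have h2 : q.imJ = 0 := by nlinarith [sq_nonneg q.imI, sq_nonneg q.imJ, sq_nonneg q.imK]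
    have h3 : q.imK = 0 := by nlinarith [sq_nonneg q.imI, sq_nonneg q.imJ, sq_nonneg q.imK]
    rw [sliceMap_ofReal]
    ext <;> simp [h1, h2, h3]
  · have hpos : 0 < q.imI ^ 2 + q.imJ ^ 2 + q.imK ^ 2 :=
      lt_of_le_of_ne (by positivity) (Ne.symm h)
    have hn : √(q.imI ^ 2 + q.imJ ^ 2 + q.imK ^ 2) ≠ 0 := (Real.sqrt_pos.2 hpos).ne'
    refine ⟨(√(q.imI ^ 2 + q.imJ ^ 2 + q.imK ^ 2))⁻¹ • q.im, ?_,
      ⟨q.re, √(q.imI ^ 2 + q.imJ ^ 2 + q.imK ^ 2)⟩, ?_⟩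
    · rw [mem_imagUnits_iff]
      simp only [Quaternion.re_smul, Quaternion.re_im, Quaternion.imI_smul,
        Quaternion.imJ_smul, Quaternion.imK_smul, Quaternion.imI_im, Quaternion.imJ_im,
        Quaternion.imK_im, smul_eq_mul, mul_pow, inv_pow, Real.sq_sqrt hpos.le]
      refine ⟨mul_zero _, ?_⟩
      field_simp
    · ext <;> simp only [sliceMap_re, sliceMap_imI, sliceMap_imJ, sliceMap_imK,
        Quaternion.re_smul, Quaternion.re_im, Quaternion.imI_smul,
        Quaternion.imJ_smul, Quaternion.imK_smul, Quaternion.imI_im, Quaternion.imJ_im,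
        Quaternion.imK_im, smul_eq_mul]
      · ring
      all_goals field_simp

/-- Two representations of a quaternion on slices are equal or conjugate. -/
theorem eq_or_conj_of_sliceMap_eq {I J : ℍ[ℝ]} (hI : I ∈ imagUnits) (hJ : J ∈ imagUnits) {z w : ℂ}
    (h : sliceMap I z = sliceMap J w) :
    (z = w ∧ star z = z) ∨ (z = w ∧ I = J) ∨ (w = star z ∧ J = -I) := by
  obtain ⟨h0, h1⟩ := mem_imagUnits_iff.1 hI
  obtain ⟨k0, k1⟩ := mem_imagUnits_iff.1 hJ
  rw [Quaternion.ext_iff] at h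
  simp only [sliceMap_re, sliceMap_imI, sliceMap_imJ, sliceMap_imK, h0, k0] at h
  obtain ⟨e0, e1, e2, e3⟩ := h
  have hsq : z.im ^ 2 = w.im ^ 2 := by
    have : (I.imI * z.im) ^ 2 + (I.imJ * z.im) ^ 2 + (I.imK * z.im) ^ 2 =
      (J.imI * w.im) ^ 2 + (J.imJ * w.im) ^ 2 + (J.imK * w.im) ^ 2 := by rw [e1, e2, e3]
    linear_combination this - z.im ^ 2 * h1 + w.im ^ 2 * k1
  by_cases hz : z.im = 0
  · have hw : w.im = 0 := by
      rw [hz] at hsq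
      exact pow_eq_zero_iff two_ne_zero |>.1 (by linarith)
    refine Or.inl ⟨Complex.ext (by linarith) (by rw [hz, hw]), Complex.ext (by simp) (by simp [hz])⟩
  · rcases sq_eq_sq_iff_eq_or_eq_neg.1 hsq with hi | hi
    · refine Or.inr (Or.inl ⟨Complex.ext (by linarith) hi, ?_⟩)
      rw [← hi] at e1 e2 e3
      ext
      · rw [h0, k0]
      · exact mul_right_cancel₀ hz e1
      · exact mul_right_cancel₀ hz e2
      · exact mul_right_cancel₀ hz e3
    · refine Or.inr (Or.inr ⟨Complex.ext (by simp; linarith) (by simp; linarith), ?_⟩)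
      have hi' : w.im = -z.im := by linarith
      rw [hi'] at e1 e2 e3
      ext
      · simp [h0, k0]
      · exact mul_right_cancel₀ hz (by simp; linarith)
      · exact mul_right_cancel₀ hz (by simp; linarith)
      · exact mul_right_cancel₀ hz (by simp; linarith)

/-- The value induced by `P` does not depend on how the point is written. At a real point the
coefficients are real, and passing from `I` to `-I` is compensated by the conjugation symmetry of
`P`. -/
theorem sliceEval_eq_of_sliceMap_eq {I J : ℍ[ℝ]} (hI : I ∈ imagUnits) (hJ : J ∈ imagUnits)
    {z w : ℂ} (h : sliceMap I z = sliceMap J w) {P : ℂ → ℍ[ℂ]}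
    (hP : P (star z) = coeffConj (P z)) : sliceEval I (P z) = sliceEval J (P w) := by
  rcases eq_or_conj_of_sliceMap_eq hI hJ h with ⟨rfl, hz⟩ | ⟨rfl, rfl⟩ | ⟨rfl, rfl⟩
  · exact sliceEval_eq_of_real I J (by rw [← hP, hz])
  · rfl
  · rw [sliceEval_neg_left, hP]
    congr 1
    ext <;> simp

theorem mem_slice {U : Set ℍ[ℝ]} {I : ℍ[ℝ]} {z : ℂ} : z ∈ slice U I ↔ sliceMap I z ∈ U := Iff.rfl

theorem onSlice_of_mem {U : Set ℍ[ℝ]} (f : U → ℍ[ℝ]) {I : ℍ[ℝ]} {z : ℂ} (h : sliceMap I z ∈ U) :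
    onSlice f I z = f ⟨sliceMap I z, h⟩ := dif_pos h

theorem IsAxiallySymmetric.slice_eq {U : Set ℍ[ℝ]} (hU : IsAxiallySymmetric U) {I J : ℍ[ℝ]}
    (hI : I ∈ imagUnits) (hJ : J ∈ imagUnits) : slice U I = slice U J :=
  Set.ext fun z => ⟨hU z I hI J hJ, hU z J hJ I hI⟩

theorem IsAxiallySymmetric.star_mem {U : Set ℍ[ℝ]} (hU : IsAxiallySymmetric U) {I : ℍ[ℝ]}
    (hI : I ∈ imagUnits) {z : ℂ} (hz : z ∈ slice U I) : star z ∈ slice U I := by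
  rw [hU.slice_eq hI (neg_mem_imagUnits hI), mem_slice, sliceMap_neg_left, star_star]
  exact hz

/-- A set all of whose slices are the same domain of the complex plane, which meets the real axis,
is a symmetric slice domain. -/
theorem isSymmetricSliceDomain_of_slice_eq {V : Set ℍ[ℝ]} {T : Set ℂ}
    (hT : ∀ I ∈ imagUnits, slice V I = T) (ho : IsOpen T) (hc : IsPreconnected T) {r : ℝ}
    (hr : (r : ℂ) ∈ T) : IsSymmetricSliceDomain V := by
  have hrV : (r : ℍ[ℝ]) ∈ V := by
    rw [← hT unitI unitI_mem, mem_slice, sliceMap_ofReal] at hr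
    exact hr
  have hcont : ∀ I, Continuous (sliceMap I) := fun I =>
    (sliceMapCLM I 1).continuous.congr fun z => by rw [sliceMapCLM_apply, mul_one]
  refine ⟨⟨?_, ⟨⟨_, hrV⟩, ?_⟩, ⟨r, hrV⟩, ?_, ?_⟩, ?_⟩
  · have himag : Continuous fun q : ℍ[ℝ] =>
        (⟨q.re, √(q.imI ^ 2 + q.imJ ^ 2 + q.imK ^ 2)⟩ : ℂ) := by
      have h : (fun q : ℍ[ℝ] => (⟨q.re, √(q.imI ^ 2 + q.imJ ^ 2 + q.imK ^ 2)⟩ : ℂ)) =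
          fun q => (q.re : ℂ) + (√(q.imI ^ 2 + q.imJ ^ 2 + q.imK ^ 2) : ℝ) * Complex.I := by
        funext q
        apply Complex.ext <;> simp
      rw [h]
      have := Quaternion.continuous_re
      have := Quaternion.continuous_imI
      have := Quaternion.continuous_imJ
      have := Quaternion.continuous_imK
      fun_prop
    -- `V` is recovered from `T` through `q ↦ Re q + i |Im q|`. The choice of sign of the imaginary
    -- part is immaterial, as the slices at `I` and `-I` are both `T` and are conjugate to each
    -- other.
    have : V = (fun q : ℍ[ℝ] => (⟨q.re, √(q.imI ^ 2 + q.imJ ^ 2 + q.imK ^ 2)⟩ : ℂ)) ⁻¹' T := by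
      ext q
      obtain ⟨I, hI, z, rfl⟩ := exists_sliceMap_eq q
      obtain ⟨h0, h1⟩ := mem_imagUnits_iff.1 hI
      have hsq : (sliceMap I z).imI ^ 2 + (sliceMap I z).imJ ^ 2 + (sliceMap I z).imK ^ 2 =
          z.im ^ 2 := by
        rw [sliceMap_imI, sliceMap_imJ, sliceMap_imK]
        linear_combination z.im ^ 2 * h1
      rw [Set.mem_preimage, hsq, Real.sqrt_sq_eq_abs, sliceMap_re, h0, zero_mul, add_zero]
      rcases abs_choice z.im with h | h
      · rw [h, ← hT I hI, mem_slice]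
      · rw [h, ← hT (-I) (neg_mem_imagUnits hI), mem_slice, sliceMap_neg_left]
        have : star (⟨z.re, -z.im⟩ : ℂ) = z := Complex.ext rfl (by simp)
        rw [this]
    rw [this]
    exact ho.preimage himag
  -- `V` is the union of the connected images of `T`, one for each `I`, and all of them contain `r`.
  · refine isPreconnected_of_forall (r : ℍ[ℝ]) fun q hq => ?_
    obtain ⟨I, hI, z, rfl⟩ := exists_sliceMap_eq q
    refine ⟨sliceMap I '' T, ?_, ⟨r, hr, sliceMap_ofReal I r⟩, ⟨z, ?_, rfl⟩,
      hc.image _ (hcont I).continuousOn⟩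
    · rintro _ ⟨w, hw, rfl⟩
      rwa [← hT I hI] at hw
    · rw [← hT I hI]
      exact hq
  · exact fun I hI => hT I hI ▸ ho
  · exact fun I hI => hT I hI ▸ ⟨⟨_, hr⟩, hc⟩
  · intro z I hI J hJ h
    rw [← mem_slice, hT I hI] at h
    rw [← mem_slice, hT J hJ]
    exact h

end Slices

/-! ### Stem functions and their complex norm -/

section Stems

/-- Stem functions: holomorphic functions with values in the complex quaternions that commute with
complex conjugation. -/
structure IsStem (D : Set ℂ) (P : ℂ → ℍ[ℂ]) : Prop where
  re : DifferentiableOn ℂ (fun z => (P z).re) D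
  imI : DifferentiableOn ℂ (fun z => (P z).imI) D
  imJ : DifferentiableOn ℂ (fun z => (P z).imJ) D
  imK : DifferentiableOn ℂ (fun z => (P z).imK) D
  conj : ∀ z ∈ D, P (star z) = coeffConj (P z)

variable {D : Set ℂ} {P Q : ℂ → ℍ[ℂ]}

theorem IsStem.conj_apply (h : IsStem D P) {z : ℂ} (hz : z ∈ D) :
    P (starRingEnd ℂ z) = coeffConj (P z) := h.conj z hz

theorem IsStem.mono {D' : Set ℂ} (h : IsStem D P) (hD : D' ⊆ D) : IsStem D' P :=
  ⟨h.re.mono hD, h.imI.mono hD, h.imJ.mono hD, h.imK.mono hD, fun z hz => h.conj z (hD hz)⟩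

theorem IsStem.congr (h : IsStem D P) (hs : ∀ z ∈ D, star z ∈ D) (he : ∀ z ∈ D, Q z = P z) :
    IsStem D Q :=
  ⟨h.re.congr fun z hz => by rw [he z hz], h.imI.congr fun z hz => by rw [he z hz],
    h.imJ.congr fun z hz => by rw [he z hz], h.imK.congr fun z hz => by rw [he z hz],
    fun z hz => by rw [he z hz, he _ (hs z hz), h.conj z hz]⟩

theorem isStem_const (D : Set ℂ) {p : ℍ[ℂ]} (hp : coeffConj p = p) : IsStem D fun _ => p :=
  ⟨differentiableOn_const _, differentiableOn_const _, differentiableOn_const _,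
    differentiableOn_const _, fun _ _ => hp.symm⟩

theorem IsStem.add (hP : IsStem D P) (hQ : IsStem D Q) : IsStem D (P + Q) :=
  ⟨hP.re.add hQ.re, hP.imI.add hQ.imI, hP.imJ.add hQ.imJ, hP.imK.add hQ.imK, fun z hz => by
    ext <;> simp [hP.conj_apply hz, hQ.conj_apply hz]⟩

theorem IsStem.neg (hP : IsStem D P) : IsStem D (-P) :=
  ⟨hP.re.neg, hP.imI.neg, hP.imJ.neg, hP.imK.neg, fun z hz => by
    ext <;> simp [hP.conj_apply hz]⟩

/-- The star of `ℍ[ℂ]` changes the sign of the vector part and does not conjugate coefficients, so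
it preserves holomorphy. -/
theorem IsStem.star (hP : IsStem D P) : IsStem D (star P) :=
  ⟨hP.re.congr fun z _ => by simp, hP.imI.neg.congr fun z _ => by simp,
    hP.imJ.neg.congr fun z _ => by simp, hP.imK.neg.congr fun z _ => by simp, fun z hz => by
    ext <;> simp [hP.conj_apply hz]⟩

theorem IsStem.mul (hP : IsStem D P) (hQ : IsStem D Q) : IsStem D (P * Q) := by
  refine ⟨?_, ?_, ?_, ?_, fun z hz => ?_⟩
  · simpa only [Pi.mul_apply, Quaternion.re_mul] using
      ((hP.re.fun_mul hQ.re).fun_sub (hP.imI.fun_mul hQ.imI)).fun_sub (hP.imJ.fun_mul hQ.imJ)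
        |>.fun_sub (hP.imK.fun_mul hQ.imK)
  · simpa only [Pi.mul_apply, Quaternion.imI_mul] using
      ((hP.re.fun_mul hQ.imI).fun_add (hP.imI.fun_mul hQ.re)).fun_add (hP.imJ.fun_mul hQ.imK)
        |>.fun_sub (hP.imK.fun_mul hQ.imJ)
  · simpa only [Pi.mul_apply, Quaternion.imJ_mul] using
      ((hP.re.fun_mul hQ.imJ).fun_sub (hP.imI.fun_mul hQ.imK)).fun_add (hP.imJ.fun_mul hQ.re)
        |>.fun_add (hP.imK.fun_mul hQ.imI)
  · simpa only [Pi.mul_apply, Quaternion.imK_mul] using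
      ((hP.re.fun_mul hQ.imK).fun_add (hP.imI.fun_mul hQ.imJ)).fun_sub (hP.imJ.fun_mul hQ.imI)
        |>.fun_add (hP.imK.fun_mul hQ.re)
  · ext <;> simp [hP.conj_apply hz, hQ.conj_apply hz]

/-- The reciprocal of a scalar stem function. -/
theorem isStem_coe_inv (hP : IsStem D P) (h : ∀ z ∈ D, (P z).re ≠ 0) :
    IsStem D fun z => (((P z).re⁻¹ : ℂ) : ℍ[ℂ]) :=
  ⟨by simpa using hP.re.fun_inv h, by simp, by simp, by simp, fun z hz => by
    ext <;> simp [hP.conj_apply hz]⟩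

/-- The stem `P P^c` of the symmetrization is scalar. -/
theorem mul_star_eq_coe (p : ℍ[ℂ]) : p * star p = ((Quaternion.normSq p : ℂ) : ℍ[ℂ]) :=
  Quaternion.self_mul_star p

theorem star_mul_eq_coe (p : ℍ[ℂ]) : star p * p = ((Quaternion.normSq p : ℂ) : ℍ[ℂ]) :=
  Quaternion.star_mul_self p

/-- Over `ℂ`, `Quaternion.normSq` is the quadratic form `a² + b² + c² + d²` without absolute values.
It is holomorphic in the coefficients, but it can vanish at a nonzero quaternion. -/
theorem IsStem.differentiableOn_normSq (hP : IsStem D P) :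
    DifferentiableOn ℂ (fun z => Quaternion.normSq (P z)) D := by
  simpa [mul_star_eq_coe] using (hP.mul hP.star).re

/-- A stem function on a domain that meets the reals is zero if its norm is zero. -/
theorem IsStem.eqOn_zero_of_normSq (hD : IsOpen D) (hc : IsPreconnected D) {r : ℝ}
    (hr : (r : ℂ) ∈ D) (hP : IsStem D P) (h : ∀ z ∈ D, Quaternion.normSq (P z) = 0) :
    ∀ z ∈ D, P z = 0 := by
  -- At a real point the symmetry makes the four coefficients real, and a vanishing sum of real
  -- squares has only zero terms.
  have key : ∀ x : ℝ, (x : ℂ) ∈ D → P x = 0 := fun x hx => by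
    have h1 := hP.conj x hx
    have h2 := h x hx
    rw [Complex.star_def, Complex.conj_ofReal, Quaternion.ext_iff] at h1
    obtain ⟨e0, e1, e2, e3⟩ := h1
    obtain ⟨a0, ha0⟩ := Complex.conj_eq_iff_real.1 e0.symm
    obtain ⟨a1, ha1⟩ := Complex.conj_eq_iff_real.1 e1.symm
    obtain ⟨a2, ha2⟩ := Complex.conj_eq_iff_real.1 e2.symm
    obtain ⟨a3, ha3⟩ := Complex.conj_eq_iff_real.1 e3.symm
    rw [Quaternion.normSq_def', ha0, ha1, ha2, ha3] at h2
    norm_cast at h2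
    have b0 : a0 = 0 := by nlinarith [sq_nonneg a0, sq_nonneg a1, sq_nonneg a2, sq_nonneg a3]
    have b1 : a1 = 0 := by nlinarith [sq_nonneg a0, sq_nonneg a1, sq_nonneg a2, sq_nonneg a3]
    have b2 : a2 = 0 := by nlinarith [sq_nonneg a0, sq_nonneg a1, sq_nonneg a2, sq_nonneg a3]
    have b3 : a3 = 0 := by nlinarith [sq_nonneg a0, sq_nonneg a1, sq_nonneg a2, sq_nonneg a3]
    ext1 <;> simp [ha0, ha1, ha2, ha3, b0, b1, b2, b3]
  intro z hz
  ext1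
  · exact eqOn_zero_of_real hD hc hr hP.re (fun x hx => by simp [key x hx]) hz
  · exact eqOn_zero_of_real hD hc hr hP.imI (fun x hx => by simp [key x hx]) hz
  · exact eqOn_zero_of_real hD hc hr hP.imJ (fun x hx => by simp [key x hx]) hz
  · exact eqOn_zero_of_real hD hc hr hP.imK (fun x hx => by simp [key x hx]) hz

/-- The stem functions on a domain that meets the reals have no zero divisors. -/
theorem IsStem.eq_zero_or_eq_zero_of_mul (hD : IsOpen D) (hc : IsPreconnected D) {r : ℝ}
    (hr : (r : ℂ) ∈ D) (hP : IsStem D P) (hQ : IsStem D Q) (h : ∀ z ∈ D, P z * Q z = 0) :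
    (∀ z ∈ D, P z = 0) ∨ ∀ z ∈ D, Q z = 0 := by
  -- The algebra `ℍ[ℂ]` itself has zero divisors, so the argument passes through the multiplicative
  -- norm, whose values are holomorphic scalar functions.
  rcases eqOn_zero_or_eqOn_zero_of_mul hD hc hP.differentiableOn_normSq hQ.differentiableOn_normSq
    (fun z hz => by rw [← map_mul, h z hz, map_zero]) with h | h
  · exact Or.inl (hP.eqOn_zero_of_normSq hD hc hr h)
  · exact Or.inr (hQ.eqOn_zero_of_normSq hD hc hr h)

end Stems


/-! ### The correspondence between regular functions and stem functions -/

section HasStem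

variable {U : Set ℍ[ℝ]} {f g h : U → ℍ[ℝ]} {P Q : ℂ → ℍ[ℂ]}

/-- The function `f` on `U` is induced by the stem function `P`. -/
structure HasStem (f : U → ℍ[ℝ]) (P : ℂ → ℍ[ℂ]) : Prop where
  isStem : IsStem (slice U unitI) P
  eq : ∀ I ∈ imagUnits, ∀ z ∈ slice U I, onSlice f I z = sliceEval I (P z)

theorem HasStem.apply (hf : HasStem f P) {I : ℍ[ℝ]} (hI : I ∈ imagUnits) {z : ℂ}
    (hz : sliceMap I z ∈ U) : f ⟨sliceMap I z, hz⟩ = sliceEval I (P z) := by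
  rw [← onSlice_of_mem f hz, hf.eq I hI z hz]

theorem funext_slice (hfg : ∀ I ∈ imagUnits, ∀ z ∈ slice U I, onSlice f I z = onSlice g I z) :
    f = g := by
  funext ⟨q, hq⟩
  obtain ⟨I, hI, z, rfl⟩ := exists_sliceMap_eq q
  rw [← onSlice_of_mem f hq, ← onSlice_of_mem g hq, hfg I hI z hq]

theorem HasStem.ext (hU : IsSymmetricSliceDomain U) (hf : HasStem f P) (hg : HasStem g Q)
    (hPQ : ∀ z ∈ slice U unitI, P z = Q z) : f = g :=
  funext_slice fun I hI z hz => by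
    rw [hf.eq I hI z hz, hg.eq I hI z hz, hPQ z (hU.symmetric.slice_eq hI unitI_mem ▸ hz)]

theorem HasStem.eqOn (hU : IsSymmetricSliceDomain U) (hf : HasStem f P) (hf' : HasStem f Q) :
    ∀ z ∈ slice U unitI, P z = Q z := fun z hz => by
  have hz' : z ∈ slice U (-unitI) :=
    hU.symmetric.slice_eq unitI_mem (neg_mem_imagUnits unitI_mem) ▸ hz
  exact sliceEval_ext (by rw [← hf.eq _ unitI_mem z hz, hf'.eq _ unitI_mem z hz])
    (by rw [← hf.eq _ (neg_mem_imagUnits unitI_mem) z hz',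
      hf'.eq _ (neg_mem_imagUnits unitI_mem) z hz'])

/-- Each quaternion is assigned an arbitrary representation on a slice; the symmetry of the stem
makes the value independent of it. -/
theorem exists_hasStem (hU : IsSymmetricSliceDomain U) (hP : IsStem (slice U unitI) P) :
    ∃ f : U → ℍ[ℝ], HasStem f P := by
  choose dir hdir coord hcoord using exists_sliceMap_eq
  refine ⟨fun q => sliceEval (dir q) (P (coord q)), hP, fun I hI z hz => ?_⟩
  rw [onSlice_of_mem _ hz]
  exact (sliceEval_eq_of_sliceMap_eq hI (hdir _) (hcoord _).symm
    (hP.conj z (hU.symmetric.slice_eq hI unitI_mem ▸ hz))).symm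

theorem HasStem.isSliceRegular (hU : IsSymmetricSliceDomain U) (hf : HasStem f P) :
    IsSliceRegular f := by
  intro I hI
  have hs := hU.symmetric.slice_eq hI unitI_mem
  have hP := hf.isStem
  rw [← hs] at hP
  exact (isLeftHolomorphic_sliceEval hI (hU.isOpen_slice I hI) hP.re hP.imI hP.imJ hP.imK).congr
    (hU.isOpen_slice I hI) (hf.eq I hI)

theorem inner_unitI_unitJ : inner ℝ unitI unitJ = 0 := by
  simp [Quaternion.inner_def]

theorem unitJ_mem : unitJ ∈ imagUnits := by simp [mem_imagUnits_iff]

theorem differentiableOn_conj_conj {D : Set ℂ} (hD : IsOpen D) (hs : ∀ z ∈ D, star z ∈ D)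
    {F : ℂ → ℂ} (hF : DifferentiableOn ℂ F D) :
    DifferentiableOn ℂ (fun z => star (F (star z))) D := fun z hz => by
  have h := (hF.differentiableAt (hD.mem_nhds (hs z hz))).conj_conj
  simp only [Complex.star_def, Complex.conj_conj] at h
  exact h.differentiableWithinAt

/-- Regular functions on symmetric slice domains are induced by stem functions. -/
theorem exists_stem (hU : IsSymmetricSliceDomain U) (hf : IsSliceRegular f) :
    ∃ P, HasStem f P := by
  have hopen := hU.isOpen_slice unitI unitI_mem
  have hs : ∀ z ∈ slice U unitI, star z ∈ slice U unitI :=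
    fun z hz => hU.symmetric.star_mem unitI_mem hz
  have hol : IsLeftHolomorphic unitI (slice U unitI) (onSlice f unitI) := hf unitI unitI_mem
  have hF : DifferentiableOn ℂ (fun z => sliceProj unitI (onSlice f unitI z)) (slice U unitI) := by
    simpa using hol.differentiableOn_sliceProj unitI_mem hopen 1
  have hG : DifferentiableOn ℂ (fun z => sliceCoproj unitI unitJ (onSlice f unitI z))
      (slice U unitI) := by
    simpa [sliceCoproj] using hol.differentiableOn_sliceProj unitI_mem hopen (-unitJ)
  have hF' := differentiableOn_conj_conj hopen hs hF
  have hG' := differentiableOn_conj_conj hopen hs hG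
  set F : ℂ → ℂ := fun z => sliceProj unitI (onSlice f unitI z) with hFdef
  set G : ℂ → ℂ := fun z => sliceCoproj unitI unitJ (onSlice f unitI z) with hGdef
  -- With `F^(z) = star (F (star z))`, write `F = A + iB` where `A = (F + F^)/2` and `B = -i(F -
  -- F^)/2` are symmetric under conjugation. They are the coefficients of `1` and `i`. Likewise `G`
  -- gives those of `j` and of `k = ij`.
  let P : ℂ → ℍ[ℂ] := fun z => ⟨(F z + star (F (star z))) / 2,
    -Complex.I * (F z - star (F (star z))) / 2, (G z + star (G (star z))) / 2,
    -Complex.I * (G z - star (G (star z))) / 2⟩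
  have hP : IsStem (slice U unitI) P := by
    refine ⟨(hF.add hF').div_const 2, ((hF.sub hF').const_mul _).div_const 2,
      (hG.add hG').div_const 2, ((hG.sub hG').const_mul _).div_const 2, fun z hz => ?_⟩
    ext1
    · change (F (star z) + star (F (star (star z)))) / 2 = star ((F z + star (F (star z))) / 2)
      simp; ring
    · change -Complex.I * (F (star z) - star (F (star (star z)))) / 2 =
        star (-Complex.I * (F z - star (F (star z))) / 2)
      simp; ring
    · change (G (star z) + star (G (star (star z)))) / 2 = star ((G z + star (G (star z))) / 2)
      simp; ring
    · change -Complex.I * (G (star z) - star (G (star (star z)))) / 2 =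
        star (-Complex.I * (G z - star (G (star z))) / 2)
      simp; ring
  refine ⟨P, hP, fun I hI z hz => ?_⟩
  obtain ⟨r, hr⟩ := hU.exists_real
  have hsI := hU.symmetric.slice_eq hI unitI_mem
  have hPI := hP
  rw [← hsI] at hPI
  -- Both sides are left holomorphic on the slice at `I`. The real points lie on every slice, so
  -- agreement there reduces to the slice at `i`, where `P` was built from `f`.
  refine IsLeftHolomorphic.eqOn_of_real (r := r) hI (hU.isOpen_slice I hI)
    (hU.isConnected_slice I hI).isPreconnected ?_ (hf I hI)
    (isLeftHolomorphic_sliceEval hI (hU.isOpen_slice I hI) hPI.re hPI.imI hPI.imJ hPI.imK) ?_ hz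
  · rw [mem_slice, sliceMap_ofReal]
    exact hr
  · intro x hx
    have hx' : (x : ℂ) ∈ slice U unitI := hsI ▸ hx
    have e1 : onSlice f I x = onSlice f unitI x := by
      rw [onSlice_of_mem f hx, onSlice_of_mem f hx']
      congr 2
      rw [sliceMap_ofReal, sliceMap_ofReal]
    have e2 : sliceEval I (P x) = sliceEval unitI (P x) := by
      apply sliceEval_eq_of_real
      rw [← hP.conj x hx', Complex.star_def, Complex.conj_ofReal]
    rw [e1, e2, ← decomp unitI_mem unitJ_mem inner_unitI_unitJ (onSlice f unitI x)]
    have e3 : ∀ a b : ℂ, sliceMap unitI ((a + b) / 2) +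
        sliceMap unitI (-Complex.I * (a - b) / 2) * unitI = sliceMap unitI a := fun a b => by
      nth_rewrite 3 [← sliceMap_I unitI]
      rw [← sliceMap_mul unitI_mem, ← sliceMap_add]
      congr 1
      linear_combination (-(a - b) / 2) * Complex.I_mul_I
    rw [sliceEval, ← unitI_mul_unitJ, ← mul_assoc, add_assoc, ← add_mul]
    simp only [P]
    rw [e3, e3]

theorem isSplitting_evalProj (hU : IsSymmetricSliceDomain U) (hf : HasStem f P) {I J : ℍ[ℝ]}
    (hI : I ∈ imagUnits) (hJ : J ∈ imagUnits) (hIJ : inner ℝ I J = 0) :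
    IsSplitting f I J (fun z => evalProj I (P z)) (fun z => evalCoproj I J (P z)) := by
  have hP := hf.isStem
  rw [← hU.symmetric.slice_eq hI unitI_mem] at hP
  refine ⟨?_, ?_, fun z hz => ?_⟩
  · exact (((hP.re.mul_const _).add (hP.imI.mul_const _)).add (hP.imJ.mul_const _)).add
      (hP.imK.mul_const _)
  · exact (((hP.re.mul_const _).add (hP.imI.mul_const _)).add (hP.imJ.mul_const _)).add
      (hP.imK.mul_const _)
  · rw [hf.eq I hI z hz, sliceEval_decomp hI hJ hIJ]

theorem IsSplitting.eq_evalProj {I J : ℍ[ℝ]} {F G : ℂ → ℂ} (hs : IsSplitting f I J F G)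
    (hf : HasStem f P) (hI : I ∈ imagUnits) (hJ : J ∈ imagUnits) (hIJ : inner ℝ I J = 0) {z : ℂ}
    (hz : z ∈ slice U I) : F z = evalProj I (P z) ∧ G z = evalCoproj I J (P z) := by
  have h := hs.eq z hz
  rw [hf.eq I hI z hz] at h
  constructor
  · rw [← sliceProj_sliceEval hI, h, sliceProj_decomp hI hJ hIJ]
  · rw [← sliceCoproj_sliceEval hI, h, sliceCoproj_decomp hI hJ hIJ]

/-- A splitting is determined by the stem, and `K (star z)` is computed from `coeffConj (Q z)`. The
formula defining `f * g` is then the product rule `evalProj_mul`, for every orthogonal pair at once.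
-/
theorem HasStem.isStarProduct (hU : IsSymmetricSliceDomain U) (hf : HasStem f P)
    (hg : HasStem g Q) (hh : HasStem h (P * Q)) : IsStarProduct f g h := by
  refine ⟨hh.isSliceRegular hU, fun I hI J hJ hIJ F G H K hFG hHK z hz => ?_⟩
  have hz' := hU.symmetric.star_mem hI hz
  obtain ⟨eF, eG⟩ := hFG.eq_evalProj hf hI hJ hIJ hz
  obtain ⟨eH, eK⟩ := hHK.eq_evalProj hg hI hJ hIJ hz
  obtain ⟨eH', eK'⟩ := hHK.eq_evalProj hg hI hJ hIJ hz'
  obtain ⟨m1, m2⟩ := evalProj_mul hI hJ hIJ (P z) (Q z)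
  rw [← hg.isStem.conj z (hU.symmetric.slice_eq hI unitI_mem ▸ hz)] at m1 m2
  rw [hh.eq I hI z hz, sliceEval_decomp hI hJ hIJ, eF, eG, eH, eK, eH', eK', Pi.mul_apply, m1, m2]

theorem HasStem.isRegularConj (hU : IsSymmetricSliceDomain U) (hf : HasStem f P)
    (hh : HasStem h (star P)) : IsRegularConj f h := by
  refine ⟨hh.isSliceRegular hU, fun I hI J hJ hIJ F G hFG z hz => ?_⟩
  have hz' := hU.symmetric.star_mem hI hz
  obtain ⟨eF, eG⟩ := hFG.eq_evalProj hf hI hJ hIJ hz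
  obtain ⟨eF', eG'⟩ := hFG.eq_evalProj hf hI hJ hIJ hz'
  obtain ⟨m1, m2⟩ := evalProj_star hI hJ hIJ (P z)
  rw [← hf.isStem.conj z (hU.symmetric.slice_eq hI unitI_mem ▸ hz)] at m1
  rw [hh.eq I hI z hz, sliceEval_decomp hI hJ hIJ, eF', eG, Pi.star_apply, m1, m2, sliceMap_neg,
    neg_mul, sub_eq_add_neg]

/-- Every `I` has an orthogonal `J`, and splittings exist because stems do. The defining formula is
therefore never vacuous and prescribes `h` on each slice. -/
theorem IsStarProduct.unique (hU : IsSymmetricSliceDomain U) (hf : HasStem f P)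
    (hg : HasStem g Q) {h h' : U → ℍ[ℝ]} (hh : IsStarProduct f g h)
    (hh' : IsStarProduct f g h') : h = h' :=
  funext_slice fun I hI z hz => by
    obtain ⟨J, hJ, hIJ⟩ := exists_orthogonal hI
    have s1 := isSplitting_evalProj hU hf hI hJ hIJ
    have s2 := isSplitting_evalProj hU hg hI hJ hIJ
    rw [hh.2 I hI J hJ hIJ _ _ _ _ s1 s2 z hz, hh'.2 I hI J hJ hIJ _ _ _ _ s1 s2 z hz]

theorem IsRegularConj.unique (hU : IsSymmetricSliceDomain U) (hf : HasStem f P)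
    {h h' : U → ℍ[ℝ]} (hh : IsRegularConj f h) (hh' : IsRegularConj f h') : h = h' :=
  funext_slice fun I hI z hz => by
    obtain ⟨J, hJ, hIJ⟩ := exists_orthogonal hI
    have s1 := isSplitting_evalProj hU hf hI hJ hIJ
    rw [hh.2 I hI J hJ hIJ _ _ s1 z hz, hh'.2 I hI J hJ hIJ _ _ s1 z hz]

/-- The function induced by the product of stems shows existence; with uniqueness, the value chosen
by `Classical.epsilon` is the only solution. -/
theorem isStarProduct_iff (hU : IsSymmetricSliceDomain U) (hf : IsSliceRegular f)
    (hg : IsSliceRegular g) : IsStarProduct f g h ↔ h = starMul f g := by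
  obtain ⟨P, hP⟩ := exists_stem hU hf
  obtain ⟨Q, hQ⟩ := exists_stem hU hg
  obtain ⟨k, hk⟩ := exists_hasStem hU (hP.isStem.mul hQ.isStem)
  have hs : IsStarProduct f g (starMul f g) :=
    Classical.epsilon_spec ⟨k, hP.isStarProduct hU hQ hk⟩
  exact ⟨fun hh => hh.unique hU hP hQ hs, fun hh => hh ▸ hs⟩

theorem isRegularConj_iff (hU : IsSymmetricSliceDomain U) (hf : IsSliceRegular f) :
    IsRegularConj f h ↔ h = regConj f := by
  obtain ⟨P, hP⟩ := exists_stem hU hf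
  obtain ⟨k, hk⟩ := exists_hasStem hU hP.isStem.star
  have hs : IsRegularConj f (regConj f) := Classical.epsilon_spec ⟨k, hP.isRegularConj hU hk⟩
  exact ⟨fun hh => hh.unique hU hP hs, fun hh => hh ▸ hs⟩

theorem HasStem.starMul (hU : IsSymmetricSliceDomain U) (hf : HasStem f P) (hg : HasStem g Q) :
    HasStem (starMul f g) (P * Q) := by
  obtain ⟨k, hk⟩ := exists_hasStem hU (hf.isStem.mul hg.isStem)
  rwa [← (isStarProduct_iff hU (hf.isSliceRegular hU) (hg.isSliceRegular hU)).1
    (hf.isStarProduct hU hg hk)]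

theorem HasStem.regConj (hU : IsSymmetricSliceDomain U) (hf : HasStem f P) :
    HasStem (regConj f) (star P) := by
  obtain ⟨k, hk⟩ := exists_hasStem hU hf.isStem.star
  rwa [← (isRegularConj_iff hU (hf.isSliceRegular hU)).1 (hf.isRegularConj hU hk)]

theorem HasStem.symmetrization (hU : IsSymmetricSliceDomain U) (hf : HasStem f P) :
    HasStem (symmetrization f) (P * star P) :=
  hf.starMul hU (hf.regConj hU)

theorem HasStem.congr (hU : IsSymmetricSliceDomain U) (hf : HasStem f P)
    (h : ∀ z ∈ slice U unitI, Q z = P z) : HasStem f Q :=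
  ⟨hf.isStem.congr (fun _ hz => hU.symmetric.star_mem unitI_mem hz) h, fun I hI z hz => by
    rw [hf.eq I hI z hz, h z (hU.symmetric.slice_eq hI unitI_mem ▸ hz)]⟩

theorem HasStem.add (hf : HasStem f P) (hg : HasStem g Q) : HasStem (f + g) (P + Q) :=
  ⟨hf.isStem.add hg.isStem, fun I hI z hz => by
    have h1 := hf.eq I hI z hz
    have h2 := hg.eq I hI z hz
    rw [onSlice_of_mem _ hz] at h1 h2 ⊢
    rw [Pi.add_apply, Pi.add_apply, sliceEval_add, h1, h2]⟩

theorem HasStem.res {V : Set ℍ[ℝ]} (hV : V ⊆ U) (hf : HasStem f P) : HasStem (res hV f) P :=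
  ⟨hf.isStem.mono fun _ hz => hV hz, fun I hI z hz => by
    rw [onSlice_of_mem _ hz]
    exact hf.apply hI (hV hz)⟩

theorem hasStem_one (U : Set ℍ[ℝ]) : HasStem (fun _ : U => 1) fun _ => 1 :=
  ⟨isStem_const _ (by ext <;> simp), fun I hI z hz => by
    rw [onSlice_of_mem _ hz]
    simpa [sliceMap_one] using (sliceEval_coe I 1).symm⟩

theorem hasStem_zero (U : Set ℍ[ℝ]) : HasStem (0 : U → ℍ[ℝ]) 0 :=
  ⟨isStem_const _ (p := 0) (by ext1 <;> exact star_zero ℂ), fun I hI z hz => by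
    rw [onSlice_of_mem _ hz]
    simpa [sliceMap_zero] using (sliceEval_coe I 0).symm⟩

end HasStem

universe u

/-! ### The ring of regular functions -/

section Ring

/-- The ring of stem functions on a subset of the complex plane. -/
def stemSubring (D : Set ℂ) : Subring (D → ℍ[ℂ]) where
  carrier := {P | ∃ Q, IsStem D Q ∧ ∀ z : D, Q z = P z}
  mul_mem' := by
    rintro _ _ ⟨P, hP, hP'⟩ ⟨Q, hQ, hQ'⟩
    exact ⟨P * Q, hP.mul hQ, fun z => by simp [hP', hQ']⟩
  one_mem' := ⟨fun _ => 1, isStem_const D (by ext <;> simp), fun _ => rfl⟩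
  add_mem' := by
    rintro _ _ ⟨P, hP, hP'⟩ ⟨Q, hQ, hQ'⟩
    exact ⟨P + Q, hP.add hQ, fun z => by simp [hP', hQ']⟩
  zero_mem' := ⟨fun _ => 0, isStem_const D (by ext <;> simp), fun _ => rfl⟩
  neg_mem' := by
    rintro _ ⟨P, hP, hP'⟩
    exact ⟨-P, hP.neg, fun z => by simp [hP']⟩

variable {U : Set ℍ[ℝ]}

/-- Regular functions on a symmetric slice domain correspond to stem functions. -/
theorem exists_equiv_stemSubring (hU : IsSymmetricSliceDomain U) :
    ∃ e : RegularFn U ≃ stemSubring (slice U unitI),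
      ∀ f P, HasStem f.1 P ↔ IsStem (slice U unitI) P ∧ ∀ z : slice U unitI, P z = (e f).1 z := by
  choose S hS using fun f : RegularFn U => exists_stem hU f.2
  let T : RegularFn U → stemSubring (slice U unitI) :=
    fun f => ⟨fun z => S f z, S f, (hS f).isStem, fun _ => rfl⟩
  have hT : Function.Bijective T := by
    constructor
    · intro f g hfg
      apply Subtype.ext
      refine (hS f).ext hU (hS g) fun z hz => ?_
      exact congrFun (congrArg Subtype.val hfg) ⟨z, hz⟩
    · rintro ⟨P, Q, hQ, hQP⟩
      obtain ⟨f, hf⟩ := exists_hasStem hU hQ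
      refine ⟨⟨f, hf.isSliceRegular hU⟩, Subtype.ext (funext fun z => ?_)⟩
      exact ((hS ⟨f, hf.isSliceRegular hU⟩).eqOn hU hf z z.2).trans (hQP z)
  refine ⟨Equiv.ofBijective T hT, fun f P => ⟨fun h => ⟨h.isStem, fun z => ?_⟩, fun h => ?_⟩⟩
  · exact h.eqOn hU (hS f) z z.2
  · exact (hS f).congr hU fun z hz => h.2 ⟨z, hz⟩

/-- The regular functions on a symmetric slice domain form a ring. -/
theorem exists_ring (hU : IsSymmetricSliceDomain U) :
    ∃ _ : Ring (RegularFn U), (∀ f g : RegularFn U, (f + g).1 = f.1 + g.1) ∧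
      (∀ f g : RegularFn U, (f * g).1 = starMul f.1 g.1) ∧
      (1 : RegularFn U).1 = (fun _ => 1) ∧ (0 : RegularFn U).1 = 0 := by
  obtain ⟨e, he⟩ := exists_equiv_stemSubring hU
  -- The ring structure is transported from stem functions; what remains is to recognize its
  -- operations as pointwise addition and the `*`-product.
  refine ⟨e.ring, ?_⟩
  let := e.ring
  have hadd : ∀ f g, e (f + g) = e f + e g := map_add e.ringEquiv
  have hmul : ∀ f g, e (f * g) = e f * e g := map_mul e.ringEquiv
  have h1 : e 1 = 1 := map_one e.ringEquiv
  have h0 : e 0 = 0 := map_zero e.ringEquiv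
  refine ⟨fun f g => ?_, fun f g => ?_, ?_, ?_⟩
  · obtain ⟨P, hP⟩ := exists_stem hU f.2
    obtain ⟨Q, hQ⟩ := exists_stem hU g.2
    refine HasStem.ext hU ((he _ _).2 ⟨hP.isStem.add hQ.isStem, fun z => ?_⟩) (hP.add hQ)
      fun z _ => rfl
    rw [hadd, Pi.add_apply, ((he _ _).1 hP).2 z, ((he _ _).1 hQ).2 z]
    rfl
  · obtain ⟨P, hP⟩ := exists_stem hU f.2
    obtain ⟨Q, hQ⟩ := exists_stem hU g.2
    refine HasStem.ext hU ((he _ _).2 ⟨hP.isStem.mul hQ.isStem, fun z => ?_⟩) (hP.starMul hU hQ)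
      fun z _ => rfl
    rw [hmul, Pi.mul_apply, ((he _ _).1 hP).2 z, ((he _ _).1 hQ).2 z]
    rfl
  · refine HasStem.ext hU ((he _ _).2 ⟨(hasStem_one U).isStem, fun z => ?_⟩) (hasStem_one U)
      fun z _ => rfl
    rw [h1]
    rfl
  · refine HasStem.ext hU ((he _ _).2 ⟨(hasStem_zero U).isStem, fun z => ?_⟩) (hasStem_zero U)
      fun z _ => rfl
    rw [h0]
    rfl

end Ring

/-! ### Fractions over a domain with central norms -/

section Ore

variable {R : Type u} [Ring R] {c : R → R} {L : Type*} [DivisionRing L] {ι : R →+* L}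

/-- In this part `c` is to be read as regular conjugation and `a * c a` as the symmetrization of
`a`. -/
theorem commute_inv_conj (hcent : ∀ a b, a * c a * b = b * (a * c a)) (a b : R) :
    Commute (ι (a * c a))⁻¹ (ι b) := by
  apply Commute.inv_left₀
  rw [Commute, SemiconjBy, ← map_mul, ← map_mul, hcent]

variable [IsDomain R]

/-- A domain with a conjugation such that all `a * c a` are central has a division ring of left
fractions. -/
theorem exists_divisionRing_of_conj (hc : ∀ a, c a * a = a * c a)
    (hcent : ∀ a b, a * c a * b = b * (a * c a)) (hne : ∀ a, a ≠ 0 → c a ≠ 0) :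
    ∃ (L : Type u) (_ : DivisionRing L) (ι : R →+* L), Function.Injective ι ∧
      ∀ x, ∃ a b, a ≠ 0 ∧ x = (ι a)⁻¹ * ι b := by
  -- The Ore condition for `r` over `s` is solved by `(s * c s) * r = (r * c s) * s`: the norm of
  -- `s` is central and ends in `s` once its factors are exchanged.
  let : OreLocalization.OreSet (nonZeroDivisors R) :=
    OreLocalization.oreSetOfNoZeroDivisors (fun r s => r * c s)
      (fun _ s => ⟨s * c s, mem_nonZeroDivisors_of_ne_zero
        (mul_ne_zero (nonZeroDivisors.coe_ne_zero s) (hne _ (nonZeroDivisors.coe_ne_zero s)))⟩)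
      (fun r s => (hcent _ r).trans (by rw [mul_assoc, hc]))
  have hinj : Function.Injective
      (OreLocalization.numeratorRingHom : R →+* OreLocalization (nonZeroDivisors R) R) :=
    OreLocalization.numeratorHom_inj inf_le_left
  refine ⟨OreLocalization (nonZeroDivisors R) R, inferInstance,
    OreLocalization.numeratorRingHom, hinj, fun x => ?_⟩
  induction x using OreLocalization.ind with
  | _ r s =>
    refine ⟨s, r, nonZeroDivisors.coe_ne_zero s, ?_⟩
    have hs : OreLocalization.numeratorRingHom (S := nonZeroDivisors R) (s : R) ≠ 0 := by
      rw [Ne, map_eq_zero_iff _ hinj]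
      exact nonZeroDivisors.coe_ne_zero s
    rw [eq_inv_mul_iff_mul_eq₀ hs]
    exact OreLocalization.mul_cancel

/-- The product of the norms of `a` and `b` is a common left multiple: the norms commute, and each
can be written with its own element as last factor. -/
theorem isLeftOreDomain_of_conj (hc : ∀ a, c a * a = a * c a)
    (hcent : ∀ a b, a * c a * b = b * (a * c a)) (hne : ∀ a, a ≠ 0 → c a ≠ 0) :
    IsLeftOreDomain R := by
  refine ⟨inferInstance, fun a b ha hb => ⟨b * c b * c a, a * c a * c b, ?_, ?_⟩⟩
  · rw [mul_assoc (b * c b), mul_assoc (a * c a), hc a, hc b, hcent b]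
  · exact mul_ne_zero (mul_ne_zero (mul_ne_zero hb (hne b hb)) (hne a ha)) ha

theorem isRightOreDomain_of_conj (hcent : ∀ a b, a * c a * b = b * (a * c a))
    (hne : ∀ a, a ≠ 0 → c a ≠ 0) : IsRightOreDomain R := by
  refine ⟨inferInstance, fun a b ha hb => ⟨c a * (b * c b), c b * (a * c a), ?_, ?_⟩⟩
  · rw [← mul_assoc, ← mul_assoc b, hcent]
  · exact mul_ne_zero ha (mul_ne_zero (hne a ha) (mul_ne_zero hb (hne b hb)))

/-- The algebraic counterpart of `f^{-*} = (1 / f^s) f^c`. It gives every fraction a central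
denominator. -/
theorem inv_eq_conj (hι : Function.Injective ι) (hc : ∀ a, c a * a = a * c a)
    (hne : ∀ a, a ≠ 0 → c a ≠ 0) {a : R} (ha : a ≠ 0) :
    (ι a)⁻¹ = (ι (a * c a))⁻¹ * ι (c a) := by
  have h0 : ∀ {a : R}, a ≠ 0 → ι a ≠ 0 := fun ha => (map_ne_zero_iff ι hι).2 ha
  rw [eq_inv_mul_iff_mul_eq₀ (h0 (mul_ne_zero ha (hne a ha))), ← hc, map_mul,
    mul_assoc, mul_inv_cancel₀ (h0 ha), mul_one]

/-- Cross-multiplication, legitimate once both denominators are replaced by central norms. -/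
theorem fraction_eq_iff (hι : Function.Injective ι) (hc : ∀ a, c a * a = a * c a)
    (hcent : ∀ a b, a * c a * b = b * (a * c a)) (hne : ∀ a, a ≠ 0 → c a ≠ 0) {a b a' b' : R}
    (ha : a ≠ 0) (ha' : a' ≠ 0) : (ι a)⁻¹ * ι b = (ι a')⁻¹ * ι b' ↔
      a' * c a' * (c a * b) = a * c a * (c a' * b') := by
  have h0 : ∀ {a : R}, a ≠ 0 → ι (a * c a) ≠ 0 := fun ha =>
    (map_ne_zero_iff ι hι).2 (mul_ne_zero ha (hne _ ha))
  rw [inv_eq_conj hι hc hne ha, inv_eq_conj hι hc hne ha', mul_assoc, mul_assoc, ← map_mul,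
    ← map_mul, inv_mul_eq_iff_eq_mul₀ (h0 ha), ← mul_assoc,
    ← (commute_inv_conj hcent a' (a * c a)).eq, mul_assoc, eq_inv_mul_iff_mul_eq₀ (h0 ha'),
    ← map_mul, ← map_mul, hι.eq_iff]

/-- Addition over a common denominator. The denominator is the product of the norms, not a smaller
multiple, in order to match the domain of a sum of `*`-quotients. -/
theorem fraction_add (hι : Function.Injective ι) (hc : ∀ a, c a * a = a * c a)
    (hcent : ∀ a b, a * c a * b = b * (a * c a)) (hne : ∀ a, a ≠ 0 → c a ≠ 0) {a b a' b' : R}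
    (ha : a ≠ 0) (ha' : a' ≠ 0) :
    (ι (a * c a * (a' * c a')))⁻¹ * ι (a' * c a' * (c a * b) + a * c a * (c a' * b')) =
      (ι a)⁻¹ * ι b + (ι a')⁻¹ * ι b' := by
  have h0 : ∀ {a : R}, a ≠ 0 → ι (a * c a) ≠ 0 := fun ha =>
    (map_ne_zero_iff ι hι).2 (mul_ne_zero ha (hne _ ha))
  have h1 := h0 ha
  have h2 := h0 ha'
  have h3 := (commute_inv_conj (ι := ι) hcent a (a' * c a')).eq
  rw [inv_eq_conj hι hc hne ha, inv_eq_conj hι hc hne ha', mul_assoc _ (ι (c a)),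
    mul_assoc _ (ι (c a')),
    ← map_mul, ← map_mul, map_add, map_mul ι _ (c a * b), map_mul ι _ (c a' * b'), mul_add]
  congr 1
  · rw [hcent, map_mul, mul_inv_rev, mul_assoc, ← mul_assoc _ _ (ι (c a * b)),
      inv_mul_cancel₀ h2, one_mul]
  · rw [map_mul, mul_inv_rev, mul_assoc, ← mul_assoc _ _ (ι (c a' * b')),
      inv_mul_cancel₀ h1, one_mul]

theorem fraction_mul (hι : Function.Injective ι) (hc : ∀ a, c a * a = a * c a)
    (hcent : ∀ a b, a * c a * b = b * (a * c a)) (hne : ∀ a, a ≠ 0 → c a ≠ 0) {a b a' b' : R}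
    (ha : a ≠ 0) (ha' : a' ≠ 0) :
    (ι (a * c a * (a' * c a')))⁻¹ * ι (c a * b * (c a' * b')) =
      (ι a)⁻¹ * ι b * ((ι a')⁻¹ * ι b') := by
  have h3 := (commute_inv_conj (ι := ι) hcent a' (c a * b)).eq
  rw [inv_eq_conj hι hc hne ha, inv_eq_conj hι hc hne ha', mul_assoc _ (ι (c a)),
    mul_assoc _ (ι (c a')), ← map_mul, ← map_mul, hcent, map_mul, mul_inv_rev,
    map_mul ι (c a * b), mul_assoc, mul_assoc, ← mul_assoc _ (ι (c a * b)), h3, mul_assoc]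

/-- A central denominator can be moved to the other side. -/
theorem exists_right_fraction (hι : Function.Injective ι) (hc : ∀ a, c a * a = a * c a)
    (hcent : ∀ a b, a * c a * b = b * (a * c a)) (hne : ∀ a, a ≠ 0 → c a ≠ 0) {a b : R}
    (ha : a ≠ 0) : (ι a)⁻¹ * ι b = ι (c a * b) * (ι (a * c a))⁻¹ := by
  rw [inv_eq_conj hι hc hne ha, mul_assoc, ← map_mul, (commute_inv_conj hcent a _).eq]

end Ore


/-! ### Reciprocals, `*`-quotients and their domains -/

section RecipDomain

variable {U : Set ℍ[ℝ]} {f g : U → ℍ[ℝ]} {P Q : ℂ → ℍ[ℂ]}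

theorem IsSymmetricSliceDomain.exists_real_mem_slice (hU : IsSymmetricSliceDomain U) :
    ∃ r : ℝ, (r : ℂ) ∈ slice U unitI := by
  obtain ⟨r, hr⟩ := hU.exists_real
  exact ⟨r, by rwa [mem_slice, sliceMap_ofReal]⟩

theorem HasStem.exists_ne_zero (hU : IsSymmetricSliceDomain U) (hf : HasStem f P) (h : f ≠ 0) :
    ∃ z ∈ slice U unitI, P z ≠ 0 := by
  by_contra! hP
  exact h (hf.ext hU (hasStem_zero U) hP)

theorem HasStem.exists_normSq_ne_zero (hU : IsSymmetricSliceDomain U) (hf : HasStem f P)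
    (h : f ≠ 0) : ∃ z ∈ slice U unitI, Quaternion.normSq (P z) ≠ 0 := by
  by_contra! hP
  obtain ⟨r, hr⟩ := hU.exists_real_mem_slice
  obtain ⟨z, hz, hne⟩ := hf.exists_ne_zero hU h
  exact hne (hf.isStem.eqOn_zero_of_normSq (hU.isOpen_slice _ unitI_mem)
    (hU.isConnected_slice _ unitI_mem).isPreconnected hr hP z hz)

/-- Removing the zeros of the norm of a stem function leaves a symmetric slice domain. -/
theorem isSymmetricSliceDomain_of_ne_zero (hU : IsSymmetricSliceDomain U) {V : Set ℍ[ℝ]}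
    {s : ℂ → ℂ} (hs : DifferentiableOn ℂ s (slice U unitI)) (hne : ∃ z ∈ slice U unitI, s z ≠ 0)
    (hV : ∀ I ∈ imagUnits, slice V I = {z | z ∈ slice U unitI ∧ s z ≠ 0}) :
    IsSymmetricSliceDomain V := by
  have ho := hU.isOpen_slice _ unitI_mem
  have hc := (hU.isConnected_slice _ unitI_mem).isPreconnected
  obtain ⟨r, hr⟩ := hU.exists_real_mem_slice
  -- The smaller set must still meet the real axis: a holomorphic function vanishing at all real
  -- points of the domain would be zero.
  obtain ⟨x, hx, hsx⟩ : ∃ x : ℝ, (x : ℂ) ∈ slice U unitI ∧ s x ≠ 0 := by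
    by_contra! h
    obtain ⟨z, hz, hsz⟩ := hne
    exact hsz (eqOn_zero_of_real ho hc hr hs h hz)
  exact isSymmetricSliceDomain_of_slice_eq hV
    (hs.continuousOn.isOpen_inter_preimage ho isOpen_compl_singleton)
    (isPreconnected_ne_zero ho hc hs) ⟨hx, hsx⟩

theorem sliceEval_coe_mul {I : ℍ[ℝ]} (hI : I ∈ imagUnits) (z : ℂ) (p : ℍ[ℂ]) :
    sliceEval I ((z : ℍ[ℂ]) * p) = sliceMap I z * sliceEval I p := by
  rw [Quaternion.coe_mul_eq_smul, sliceEval_smul hI]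

theorem coe_mul_coe_mul (a b : ℂ) (x : ℍ[ℂ]) : (a : ℍ[ℂ]) * (b * x) = (a * b : ℂ) * x := by
  rw [Quaternion.coe_mul, mul_assoc]

theorem coe_inv_mul_eq_iff {n n' : ℂ} (hn : n ≠ 0) (hn' : n' ≠ 0) (x y : ℍ[ℂ]) :
    ((n⁻¹ : ℂ) : ℍ[ℂ]) * x = ((n'⁻¹ : ℂ) : ℍ[ℂ]) * y ↔ (n' : ℍ[ℂ]) * x = n * y := by
  constructor
  · intro h
    have h1 := congrArg (fun q => ((n * n' : ℂ) : ℍ[ℂ]) * q) h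
    simp only [coe_mul_coe_mul] at h1
    rwa [show n * n' * n⁻¹ = n' by field_simp, show n * n' * n'⁻¹ = n by field_simp] at h1
  · intro h
    have h1 := congrArg (fun q => ((n⁻¹ * n'⁻¹ : ℂ) : ℍ[ℂ]) * q) h
    simp only [coe_mul_coe_mul] at h1
    rwa [show n⁻¹ * n'⁻¹ * n' = n⁻¹ by field_simp, show n⁻¹ * n'⁻¹ * n = n'⁻¹ by field_simp] at h1

/-- The right side has the form of the stem of a `*`-quotient with denominator `k = n n'`. As `k` is
scalar, `star k = k` and its norm is `k²`, so the factor is just `k⁻¹`. -/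
theorem coe_inv_mul_add {n n' : ℂ} (hn : n ≠ 0) (hn' : n' ≠ 0) (x y : ℍ[ℂ]) :
    ((n⁻¹ : ℂ) : ℍ[ℂ]) * x + ((n'⁻¹ : ℂ) : ℍ[ℂ]) * y =
      (((Quaternion.normSq ((n : ℍ[ℂ]) * n'))⁻¹ : ℂ) : ℍ[ℂ]) *
        (star ((n : ℍ[ℂ]) * n') * (n' * x + n * y)) := by
  rw [← Quaternion.coe_mul, Quaternion.normSq_coe, Quaternion.star_coe]
  simp only [mul_add, coe_mul_coe_mul]
  congr 3 <;> field_simp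

theorem coe_inv_mul_mul {n n' : ℂ} (hn : n ≠ 0) (hn' : n' ≠ 0) (x y : ℍ[ℂ]) :
    ((n⁻¹ : ℂ) : ℍ[ℂ]) * x * (((n'⁻¹ : ℂ) : ℍ[ℂ]) * y) =
      (((Quaternion.normSq ((n : ℍ[ℂ]) * n'))⁻¹ : ℂ) : ℍ[ℂ]) *
        (star ((n : ℍ[ℂ]) * n') * (x * y)) := by
  rw [← Quaternion.coe_mul, Quaternion.normSq_coe, Quaternion.star_coe, coe_mul_coe_mul,
    mul_assoc, ← mul_assoc x, ← Quaternion.coe_commutes, mul_assoc _ x, coe_mul_coe_mul]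
  congr 2
  field_simp

theorem sliceMap_eq_zero {I : ℍ[ℝ]} (hI : I ∈ imagUnits) {z : ℂ} : sliceMap I z = 0 ↔ z = 0 := by
  constructor
  · intro h
    rw [← sliceProj_sliceMap hI z, h, ← sliceMap_zero I, sliceProj_sliceMap hI]
  · rintro rfl
    exact sliceMap_zero I

theorem sliceMap_inv {I : ℍ[ℝ]} (hI : I ∈ imagUnits) (z : ℂ) :
    sliceMap I z⁻¹ = (sliceMap I z)⁻¹ := by
  by_cases hz : z = 0
  · simp [hz, sliceMap_zero]
  · refine eq_inv_of_mul_eq_one_left ?_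
    rw [← sliceMap_mul hI, inv_mul_cancel₀ hz, sliceMap_one]

/-- The stem of `f^s` is scalar, so its values on the slice at `I` stay in `ℝ + I ℝ`. Consequently
its zeros lie over the same `z` for every `I`. -/
theorem HasStem.symmetrization_apply (hU : IsSymmetricSliceDomain U) (hf : HasStem f P)
    {I : ℍ[ℝ]} (hI : I ∈ imagUnits) {z : ℂ} (hz : sliceMap I z ∈ U) :
    SliceRegular.symmetrization f ⟨sliceMap I z, hz⟩ = sliceMap I (Quaternion.normSq (P z)) := by
  rw [(hf.symmetrization hU).apply hI hz, Pi.mul_apply, Pi.star_apply, mul_star_eq_coe,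
    sliceEval_coe]

theorem HasStem.slice_recipDomain (hU : IsSymmetricSliceDomain U) (hf : HasStem f P) :
    ∀ I ∈ imagUnits, slice (recipDomain f) I =
      {z | z ∈ slice U unitI ∧ Quaternion.normSq (P z) ≠ 0} := by
  intro I hI
  ext z
  rw [← hU.symmetric.slice_eq hI unitI_mem]
  constructor
  · rintro ⟨hz, h⟩
    rw [hf.symmetrization_apply hU hI, Ne, sliceMap_eq_zero hI] at h
    exact ⟨hz, h⟩
  · rintro ⟨hz, h⟩
    exact ⟨hz, fun h0 => h ((sliceMap_eq_zero hI).1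
      ((hf.symmetrization_apply hU hI hz).symm.trans h0))⟩

theorem HasStem.isSymmetricSliceDomain_recipDomain (hU : IsSymmetricSliceDomain U)
    (hf : HasStem f P) (h : f ≠ 0) : IsSymmetricSliceDomain (recipDomain f) :=
  isSymmetricSliceDomain_of_ne_zero hU hf.isStem.differentiableOn_normSq
    (hf.exists_normSq_ne_zero hU h) (hf.slice_recipDomain hU)

/-- The definition of `f^{-*}` multiplies pointwise by `1 / f^s`. This agrees with the product of
stems because the left factor is scalar. -/
theorem HasStem.starInv (hU : IsSymmetricSliceDomain U) (hf : HasStem f P) :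
    HasStem (starInv f) fun z => (((Quaternion.normSq (P z))⁻¹ : ℂ) : ℍ[ℂ]) * star (P z) := by
  have hD := hf.slice_recipDomain hU unitI unitI_mem
  have hP : IsStem (slice (recipDomain f) unitI) P :=
    hf.isStem.mono fun z hz => by rw [hD] at hz; exact hz.1
  have hre : ∀ z, ((P * star P) z).re = Quaternion.normSq (P z) := fun z => by
    rw [Pi.mul_apply, Pi.star_apply, mul_star_eq_coe, Quaternion.re_coe]
  refine ⟨?_, fun I hI z hz => ?_⟩
  · have h := (isStem_coe_inv (hP.mul hP.star) fun z hz => by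
      rw [hD] at hz
      rw [hre]
      exact hz.2).mul hP.star
    have he : (fun z => (((Quaternion.normSq (P z))⁻¹ : ℂ) : ℍ[ℂ]) * star (P z)) =
        (fun z => ((((P * star P) z).re⁻¹ : ℂ) : ℍ[ℂ])) * star P := by
      funext z
      rw [Pi.mul_apply, hre, Pi.star_apply]
    rwa [he]
  · have hzU : sliceMap I z ∈ U := recipDomain_subset f hz
    rw [onSlice_of_mem _ hz, sliceEval_coe_mul hI, sliceMap_inv hI,
      ← hf.symmetrization_apply hU hI hzU, ← Pi.star_apply, ← (hf.regConj hU).apply hI hzU]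
    rfl

theorem HasStem.starQuotient (hU : IsSymmetricSliceDomain U) (hf : HasStem f P)
    (hg : HasStem g Q) (h : f ≠ 0) : HasStem (starQuotient f g).asSubtype
      fun z => (((Quaternion.normSq (P z))⁻¹ : ℂ) : ℍ[ℂ]) * (star (P z) * Q z) := by
  have h1 := (hf.starInv hU).starMul (hf.isSymmetricSliceDomain_recipDomain hU h)
    (hg.res (recipDomain_subset f))
  have he : (fun z => (((Quaternion.normSq (P z))⁻¹ : ℂ) : ℍ[ℂ]) * (star (P z) * Q z)) =
      (fun z => (((Quaternion.normSq (P z))⁻¹ : ℂ) : ℍ[ℂ]) * star (P z)) * Q := by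
    funext z
    rw [Pi.mul_apply, mul_assoc]
  rw [he]
  exact h1

theorem starQuotient_dom (f g : U → ℍ[ℝ]) : (starQuotient f g).Dom = recipDomain f := rfl

theorem eq_of_slice_eq {V W : Set ℍ[ℝ]} (h : ∀ I ∈ imagUnits, slice V I = slice W I) : V = W := by
  ext q
  obtain ⟨I, hI, z, rfl⟩ := exists_sliceMap_eq q
  rw [← mem_slice, h I hI, mem_slice]

theorem pfun_ext {φ ψ : ℍ[ℝ] →. ℍ[ℝ]} (hφ : HasStem φ.asSubtype P) (hψ : HasStem ψ.asSubtype Q)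
    {T : Set ℂ} (h1 : ∀ I ∈ imagUnits, slice φ.Dom I = T)
    (h2 : ∀ I ∈ imagUnits, slice ψ.Dom I = T) (h : ∀ z ∈ T, P z = Q z) : φ = ψ := by
  have hdom : φ.Dom = ψ.Dom := eq_of_slice_eq fun I hI => by rw [h1 I hI, h2 I hI]
  refine PFun.ext' (fun q => by rw [hdom]) fun q hq hq' => ?_
  obtain ⟨I, hI, z, rfl⟩ := exists_sliceMap_eq q
  have e1 := hφ.apply hI hq
  have e2 := hψ.apply hI hq'
  have hz : z ∈ T := h1 I hI ▸ hq
  rw [h z hz] at e1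
  exact e1.trans e2.symm

end RecipDomain

/-! ### Arithmetic of `*`-quotients expressed in the ring of regular functions -/

/-- The ring structure of the regular functions is given by pointwise addition and the
`*`-product. -/
structure IsStarRing (U : Set ℍ[ℝ]) [Ring (RegularFn U)] : Prop where
  add : ∀ f g : RegularFn U, (f + g).1 = f.1 + g.1
  mul : ∀ f g : RegularFn U, (f * g).1 = starMul f.1 g.1
  one : (1 : RegularFn U).1 = fun _ => 1
  zero : (0 : RegularFn U).1 = 0

/-- The regular conjugate as a regular function. -/
noncomputable def regularConj {U : Set ℍ[ℝ]} (hU : IsSymmetricSliceDomain U) (f : RegularFn U) :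
    RegularFn U := ⟨regConj f.1, ((isRegularConj_iff hU f.2).2 rfl).1⟩

section StarRing

variable {U : Set ℍ[ℝ]} [Ring (RegularFn U)] {P Q : ℂ → ℍ[ℂ]}

theorem IsStarRing.hasStem_add (hR : IsStarRing U) {f g : RegularFn U} (hf : HasStem f.1 P)
    (hg : HasStem g.1 Q) : HasStem (f + g).1 (P + Q) := by
  rw [hR.add]
  exact hf.add hg

theorem IsStarRing.hasStem_mul (hR : IsStarRing U) (hU : IsSymmetricSliceDomain U)
    {f g : RegularFn U} (hf : HasStem f.1 P) (hg : HasStem g.1 Q) :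
    HasStem (f * g).1 (P * Q) := by
  rw [hR.mul]
  exact hf.starMul hU hg

theorem IsStarRing.ne_zero_iff (hR : IsStarRing U) {f : RegularFn U} : f ≠ 0 ↔ f.1 ≠ 0 := by
  rw [Ne, Ne, Subtype.ext_iff, hR.zero]

theorem IsStarRing.isDomain (hR : IsStarRing U) (hU : IsSymmetricSliceDomain U) :
    IsDomain (RegularFn U) := by
  have : NoZeroDivisors (RegularFn U) := ⟨fun {f g} h => by
    obtain ⟨P, hP⟩ := exists_stem hU f.2
    obtain ⟨Q, hQ⟩ := exists_stem hU g.2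
    obtain ⟨r, hr⟩ := hU.exists_real_mem_slice
    have hPQ := hR.hasStem_mul hU hP hQ
    rw [h, hR.zero] at hPQ
    rcases hP.isStem.eq_zero_or_eq_zero_of_mul (hU.isOpen_slice _ unitI_mem)
      (hU.isConnected_slice _ unitI_mem).isPreconnected hr hQ.isStem
      (hPQ.eqOn hU (hasStem_zero U)) with h0 | h0
    · exact Or.inl (Subtype.ext (by rw [hR.zero]; exact hP.ext hU (hasStem_zero U) h0))
    · exact Or.inr (Subtype.ext (by rw [hR.zero]; exact hQ.ext hU (hasStem_zero U) h0))⟩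
  have : Nontrivial (RegularFn U) := ⟨1, 0, by
    rw [hR.ne_zero_iff, hR.one]
    obtain ⟨r, hr⟩ := hU.exists_real
    intro h
    exact one_ne_zero (congrFun h ⟨_, hr⟩)⟩
  exact NoZeroDivisors.to_isDomain _

theorem IsStarRing.conj_mul_self (hR : IsStarRing U) (hU : IsSymmetricSliceDomain U)
    (f : RegularFn U) : regularConj hU f * f = f * regularConj hU f := by
  obtain ⟨P, hP⟩ := exists_stem hU f.2
  have hc : HasStem (regularConj hU f).1 (star P) := hP.regConj hU
  refine Subtype.ext ((hR.hasStem_mul hU hc hP).ext hU (hR.hasStem_mul hU hP hc) fun z _ => ?_)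
  rw [Pi.mul_apply, Pi.mul_apply, Pi.star_apply, mul_star_eq_coe, star_mul_eq_coe]

theorem IsStarRing.mul_conj_comm (hR : IsStarRing U) (hU : IsSymmetricSliceDomain U)
    (f g : RegularFn U) : f * regularConj hU f * g = g * (f * regularConj hU f) := by
  obtain ⟨P, hP⟩ := exists_stem hU f.2
  obtain ⟨Q, hQ⟩ := exists_stem hU g.2
  have hc : HasStem (regularConj hU f).1 (star P) := hP.regConj hU
  have hn := hR.hasStem_mul hU hP hc
  refine Subtype.ext ((hR.hasStem_mul hU hn hQ).ext hU (hR.hasStem_mul hU hQ hn) fun z _ => ?_)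
  simp only [Pi.mul_apply, Pi.star_apply, mul_star_eq_coe]
  exact (Quaternion.coe_commutes _ _)

theorem IsStarRing.conj_ne_zero (hR : IsStarRing U) (hU : IsSymmetricSliceDomain U)
    (f : RegularFn U) (hf : f ≠ 0) : regularConj hU f ≠ 0 := by
  obtain ⟨P, hP⟩ := exists_stem hU f.2
  have hc : HasStem (regularConj hU f).1 (star P) := hP.regConj hU
  intro h
  rw [h, hR.zero] at hc
  refine hf (Subtype.ext ?_)
  rw [hR.zero]
  refine hP.ext hU (hasStem_zero U) fun z hz => ?_
  have h1 := hc.eqOn hU (hasStem_zero U) z hz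
  rw [Pi.star_apply, Pi.zero_apply] at h1
  rw [← star_star (P z), h1]
  exact star_zero _

variable {f g f' g' : RegularFn U}

/-- Two `*`-quotients coincide on the common domain if and only if they are equal as fractions. -/
theorem IsStarRing.starQuotient_eq_iff (hR : IsStarRing U) (hU : IsSymmetricSliceDomain U)
    (hf : f.1 ≠ 0) (hf' : f'.1 ≠ 0) :
    (∀ q (h : q ∈ (starQuotient f.1 g.1).Dom) (h' : q ∈ (starQuotient f'.1 g'.1).Dom),
      (starQuotient f.1 g.1).fn q h = (starQuotient f'.1 g'.1).fn q h') ↔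
    f' * regularConj hU f' * (regularConj hU f * g) =
      f * regularConj hU f * (regularConj hU f' * g') := by
  obtain ⟨P, hP⟩ := exists_stem hU f.2
  obtain ⟨Q, hQ⟩ := exists_stem hU g.2
  obtain ⟨P', hP'⟩ := exists_stem hU f'.2
  obtain ⟨Q', hQ'⟩ := exists_stem hU g'.2
  have hc : HasStem (regularConj hU f).1 (star P) := hP.regConj hU
  have hc' : HasStem (regularConj hU f').1 (star P') := hP'.regConj hU
  have hs := hP.starQuotient hU hQ hf
  have hs' := hP'.starQuotient hU hQ' hf'
  have hl := hR.hasStem_mul hU (hR.hasStem_mul hU hP' hc') (hR.hasStem_mul hU hc hQ)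
  have hr := hR.hasStem_mul hU (hR.hasStem_mul hU hP hc) (hR.hasStem_mul hU hc' hQ')
  -- Both identities are pointwise statements about stems; the first is required only off the zeros
  -- of the two norms.
  have key : (∀ z ∈ slice U unitI, Quaternion.normSq (P z) ≠ 0 →
      Quaternion.normSq (P' z) ≠ 0 → (((Quaternion.normSq (P z))⁻¹ : ℂ) : ℍ[ℂ]) * (star (P z) * Q z) =
        (((Quaternion.normSq (P' z))⁻¹ : ℂ) : ℍ[ℂ]) * (star (P' z) * Q' z)) ↔
      ∀ z ∈ slice U unitI, ((Quaternion.normSq (P' z) : ℂ) : ℍ[ℂ]) * (star (P z) * Q z) =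
        ((Quaternion.normSq (P z) : ℂ) : ℍ[ℂ]) * (star (P' z) * Q' z) := by
    constructor
    · intro h
      -- The difference of the two sides, multiplied by both norms, vanishes everywhere, including
      -- at the excluded points. The product of the norms is a nonzero stem, so it can be cancelled.
      have hT : IsStem (slice U unitI) ((P' * star P') * (star P * Q) +
          -((P * star P) * (star P' * Q'))) := hl.isStem.add hr.isStem.neg
      obtain ⟨r, hr⟩ := hU.exists_real_mem_slice
      rcases (((hP.isStem.mul hP.isStem.star).mul (hP'.isStem.mul hP'.isStem.star))
        ).eq_zero_or_eq_zero_of_mul (hU.isOpen_slice _ unitI_mem)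
        (hU.isConnected_slice _ unitI_mem).isPreconnected hr hT (fun z hz => by
          simp only [Pi.mul_apply, Pi.star_apply, mul_star_eq_coe, Pi.add_apply, Pi.neg_apply]
          by_cases hn : Quaternion.normSq (P z) = 0
          · simp [hn]
          by_cases hn' : Quaternion.normSq (P' z) = 0
          · simp [hn']
          rw [(coe_inv_mul_eq_iff hn hn' _ _).1 (h z hz hn hn'), add_neg_cancel, mul_zero]) with h0 | h0
      · exfalso
        have h1 : f * regularConj hU f * (f' * regularConj hU f') = 0 := Subtype.ext (by
          rw [hR.zero]
          exact (hR.hasStem_mul hU (hR.hasStem_mul hU hP hc) (hR.hasStem_mul hU hP' hc')).ext hU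
            (hasStem_zero U) h0)
        have := hR.isDomain hU
        rw [← hR.ne_zero_iff] at hf hf'
        exact mul_ne_zero (mul_ne_zero hf (hR.conj_ne_zero hU f hf))
          (mul_ne_zero hf' (hR.conj_ne_zero hU f' hf')) h1
      · intro z hz
        have h1 := h0 z hz
        simp only [Pi.mul_apply, Pi.star_apply, mul_star_eq_coe, Pi.add_apply, Pi.neg_apply] at h1
        exact add_neg_eq_zero.1 h1
    · exact fun h z hz hn hn' => (coe_inv_mul_eq_iff hn hn' _ _).2 (h z hz)
  have hring : f' * regularConj hU f' * (regularConj hU f * g) =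
      f * regularConj hU f * (regularConj hU f' * g') ↔
      ∀ z ∈ slice U unitI, ((Quaternion.normSq (P' z) : ℂ) : ℍ[ℂ]) * (star (P z) * Q z) =
        ((Quaternion.normSq (P z) : ℂ) : ℍ[ℂ]) * (star (P' z) * Q' z) := by
    have hpt : ∀ z, ((P' * star P') * (star P * Q)) z = ((P * star P) * (star P' * Q')) z ↔
        ((Quaternion.normSq (P' z) : ℂ) : ℍ[ℂ]) * (star (P z) * Q z) =
          ((Quaternion.normSq (P z) : ℂ) : ℍ[ℂ]) * (star (P' z) * Q' z) := fun z => by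
      simp only [Pi.mul_apply, Pi.star_apply, mul_star_eq_coe]
    constructor
    · intro h z hz
      rw [h] at hl
      exact (hpt z).1 (hl.eqOn hU hr z hz)
    · exact fun h => Subtype.ext (hl.ext hU hr fun z hz => (hpt z).2 (h z hz))
  rw [hring, ← key]
  constructor
  · intro h z hz hn hn'
    have hd : ∀ I ∈ imagUnits, sliceMap I z ∈ (starQuotient f.1 g.1).Dom := fun I hI => by
      rw [← mem_slice, starQuotient_dom, hP.slice_recipDomain hU I hI]
      exact ⟨hz, hn⟩
    have hd' : ∀ I ∈ imagUnits, sliceMap I z ∈ (starQuotient f'.1 g'.1).Dom := fun I hI => by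
      rw [← mem_slice, starQuotient_dom, hP'.slice_recipDomain hU I hI]
      exact ⟨hz, hn'⟩
    have he : ∀ I ∈ imagUnits, sliceEval I ((((Quaternion.normSq (P z))⁻¹ : ℂ) : ℍ[ℂ]) * (star (P z) * Q z)) =
        sliceEval I ((((Quaternion.normSq (P' z))⁻¹ : ℂ) : ℍ[ℂ]) * (star (P' z) * Q' z)) := fun I hI =>
      (hs.apply hI (hd I hI)).symm.trans ((h _ (hd I hI) (hd' I hI)).trans
        (hs'.apply hI (hd' I hI)))
    -- Equality of functions gives equality of stems by comparing the slices at `i` and at `-i`.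
    exact sliceEval_ext (he _ unitI_mem) (he _ (neg_mem_imagUnits unitI_mem))
  · intro h q hq hq'
    obtain ⟨I, hI, z, rfl⟩ := exists_sliceMap_eq q
    have m1 : z ∈ slice (recipDomain f.1) I := hq
    have m2 : z ∈ slice (recipDomain f'.1) I := hq'
    rw [hP.slice_recipDomain hU I hI] at m1
    rw [hP'.slice_recipDomain hU I hI] at m2
    refine (hs.apply hI hq).trans (Eq.trans ?_ (hs'.apply hI hq').symm)
    rw [h z m1.1 m1.2 m2.2]

/-- The norm of this denominator is `N(P)² N(P')²`, so its zeros are exactly those of `N(P)` and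
`N(P')` together. Sums and products thus equal `*`-quotients as partial functions, domains included.
-/
theorem IsStarRing.slice_mul_norm (hR : IsStarRing U) (hU : IsSymmetricSliceDomain U)
    {P' : ℂ → ℍ[ℂ]} (hP : HasStem f.1 P) (hP' : HasStem f'.1 P') (I : ℍ[ℝ]) (hI : I ∈ imagUnits) :
    slice (recipDomain (f * regularConj hU f * (f' * regularConj hU f')).1) I =
      slice (recipDomain f.1 ∩ recipDomain f'.1) I := by
  have hc : HasStem (regularConj hU f).1 (star P) := hP.regConj hU
  have hc' : HasStem (regularConj hU f').1 (star P') := hP'.regConj hU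
  have hk := hR.hasStem_mul hU (hR.hasStem_mul hU hP hc) (hR.hasStem_mul hU hP' hc')
  have h1 := hP.slice_recipDomain hU I hI
  have h2 := hP'.slice_recipDomain hU I hI
  rw [hk.slice_recipDomain hU I hI]
  change _ = slice (recipDomain f.1) I ∩ slice (recipDomain f'.1) I
  rw [h1, h2]
  ext z
  simp only [Pi.mul_apply, Pi.star_apply, map_mul, Quaternion.normSq_star, Set.mem_ofPred_eq,
    Set.mem_inter_iff, Ne, mul_eq_zero]
  tauto

theorem IsStarRing.norm_mul_norm_ne_zero (hR : IsStarRing U) (hU : IsSymmetricSliceDomain U)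
    (hf : f.1 ≠ 0) (hf' : f'.1 ≠ 0) :
    (f * regularConj hU f * (f' * regularConj hU f')).1 ≠ 0 := by
  have := hR.isDomain hU
  rw [← hR.ne_zero_iff] at hf hf' ⊢
  exact mul_ne_zero (mul_ne_zero hf (hR.conj_ne_zero hU f hf))
    (mul_ne_zero hf' (hR.conj_ne_zero hU f' hf'))

/-- The sum of two `*`-quotients is a `*`-quotient. -/
theorem IsStarRing.addPFun_starQuotient (hR : IsStarRing U) (hU : IsSymmetricSliceDomain U)
    (hf : f.1 ≠ 0) (hf' : f'.1 ≠ 0) :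
    addPFun (starQuotient f.1 g.1) (starQuotient f'.1 g'.1) =
      starQuotient (f * regularConj hU f * (f' * regularConj hU f')).1
        (f' * regularConj hU f' * (regularConj hU f * g) +
          f * regularConj hU f * (regularConj hU f' * g')).1 := by
  obtain ⟨P, hP⟩ := exists_stem hU f.2
  obtain ⟨Q, hQ⟩ := exists_stem hU g.2
  obtain ⟨P', hP'⟩ := exists_stem hU f'.2
  obtain ⟨Q', hQ'⟩ := exists_stem hU g'.2
  have hc : HasStem (regularConj hU f).1 (star P) := hP.regConj hU
  have hc' : HasStem (regularConj hU f').1 (star P') := hP'.regConj hU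
  have hs := hP.starQuotient hU hQ hf
  have hs' := hP'.starQuotient hU hQ' hf'
  have hk := hR.hasStem_mul hU (hR.hasStem_mul hU hP hc) (hR.hasStem_mul hU hP' hc')
  have hl := hR.hasStem_mul hU (hR.hasStem_mul hU hP' hc') (hR.hasStem_mul hU hc hQ)
  have hr := hR.hasStem_mul hU (hR.hasStem_mul hU hP hc) (hR.hasStem_mul hU hc' hQ')
  have hsum : HasStem (addPFun (starQuotient f.1 g.1) (starQuotient f'.1 g'.1)).asSubtype _ :=
    (hs.res Set.inter_subset_left).add (hs'.res Set.inter_subset_right)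
  have hdom := hR.slice_mul_norm hU hP hP'
  refine pfun_ext (T := slice (recipDomain f.1 ∩ recipDomain f'.1) unitI) hsum
    (hk.starQuotient hU (hR.hasStem_add hl hr) (hR.norm_mul_norm_ne_zero hU hf hf')) ?_ ?_ ?_
  · intro I hI
    change slice (recipDomain f.1 ∩ recipDomain f'.1) I = _
    rw [← hdom I hI, ← hdom unitI unitI_mem, hk.slice_recipDomain hU I hI,
      hk.slice_recipDomain hU _ unitI_mem]
  · intro I hI
    rw [starQuotient_dom, ← hdom unitI unitI_mem, hk.slice_recipDomain hU I hI,
      hk.slice_recipDomain hU _ unitI_mem]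
  · rintro z ⟨hz, hz'⟩
    have m1 : z ∈ slice (recipDomain f.1) unitI := hz
    have m2 : z ∈ slice (recipDomain f'.1) unitI := hz'
    rw [hP.slice_recipDomain hU _ unitI_mem] at m1
    rw [hP'.slice_recipDomain hU _ unitI_mem] at m2
    simp only [Pi.mul_apply, Pi.add_apply, Pi.star_apply, mul_star_eq_coe]
    exact coe_inv_mul_add m1.2 m2.2 _ _

/-- The `*`-product of two `*`-quotients is a `*`-quotient. -/
theorem IsStarRing.starMulPFun_starQuotient (hR : IsStarRing U) (hU : IsSymmetricSliceDomain U)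
    (hf : f.1 ≠ 0) (hf' : f'.1 ≠ 0) :
    starMulPFun (starQuotient f.1 g.1) (starQuotient f'.1 g'.1) =
      starQuotient (f * regularConj hU f * (f' * regularConj hU f')).1
        (regularConj hU f * g * (regularConj hU f' * g')).1 := by
  obtain ⟨P, hP⟩ := exists_stem hU f.2
  obtain ⟨Q, hQ⟩ := exists_stem hU g.2
  obtain ⟨P', hP'⟩ := exists_stem hU f'.2
  obtain ⟨Q', hQ'⟩ := exists_stem hU g'.2
  have hc : HasStem (regularConj hU f).1 (star P) := hP.regConj hU
  have hc' : HasStem (regularConj hU f').1 (star P') := hP'.regConj hU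
  have hs := hP.starQuotient hU hQ hf
  have hs' := hP'.starQuotient hU hQ' hf'
  have hk := hR.hasStem_mul hU (hR.hasStem_mul hU hP hc) (hR.hasStem_mul hU hP' hc')
  have hl := hR.hasStem_mul hU (hR.hasStem_mul hU hc hQ) (hR.hasStem_mul hU hc' hQ')
  have hdom := hR.slice_mul_norm hU hP hP'
  have hne := hR.norm_mul_norm_ne_zero hU hf hf'
  have hV : IsSymmetricSliceDomain (recipDomain f.1 ∩ recipDomain f'.1) := by
    rw [← eq_of_slice_eq hdom]
    exact hk.isSymmetricSliceDomain_recipDomain hU hne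
  have hprod : HasStem (starMulPFun (starQuotient f.1 g.1) (starQuotient f'.1 g'.1)).asSubtype _ :=
    HasStem.starMul hV (hs.res Set.inter_subset_left) (hs'.res Set.inter_subset_right)
  refine pfun_ext (T := slice (recipDomain f.1 ∩ recipDomain f'.1) unitI) hprod
    (hk.starQuotient hU hl hne) ?_ ?_ ?_
  · exact fun I hI => hV.symmetric.slice_eq hI unitI_mem
  · intro I hI
    rw [starQuotient_dom, hdom I hI, hV.symmetric.slice_eq hI unitI_mem]
  · rintro z ⟨hz, hz'⟩
    have m1 : z ∈ slice (recipDomain f.1) unitI := hz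
    have m2 : z ∈ slice (recipDomain f'.1) unitI := hz'
    rw [hP.slice_recipDomain hU _ unitI_mem] at m1
    rw [hP'.slice_recipDomain hU _ unitI_mem] at m2
    simp only [Pi.mul_apply, Pi.star_apply, mul_star_eq_coe]
    exact coe_inv_mul_mul m1.2 m2.2 _ _

end StarRing


/-! ### Classes of `*`-quotients as abstract fractions -/

section QuotientRing

variable {U : Set ℍ[ℝ]} {P Q : ℂ → ℍ[ℂ]}

theorem one_ne_zero_regular (hU : IsSymmetricSliceDomain U) : (fun _ : U => (1 : ℍ[ℝ])) ≠ 0 := by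
  obtain ⟨r, hr⟩ := hU.exists_real
  intro h
  exact one_ne_zero (congrFun h ⟨_, hr⟩)

/-- The norm of the constant stem `1` is `1`, so no point is removed from the domain. -/
theorem starQuotient_one (hU : IsSymmetricSliceDomain U) (f : RegularFn U) :
    starQuotient (fun _ => 1) f.1 = toPFun f.1 := by
  obtain ⟨P, hP⟩ := exists_stem hU f.2
  have h1 := hasStem_one U
  have hne := one_ne_zero_regular hU
  have hf : HasStem (toPFun f.1).asSubtype P := hP
  refine pfun_ext (T := slice U unitI) (h1.starQuotient hU hP hne) hf (fun I hI => ?_)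
    (fun I hI => hU.symmetric.slice_eq hI unitI_mem) (fun z _ => by simp)
  rw [starQuotient_dom, h1.slice_recipDomain hU I hI]
  ext z
  simp

/-- The `*`-quotients modulo coincidence are in bijection with the elements of a division ring of
fractions of the regular functions. -/
theorem IsStarRing.exists_equiv_quotientRing [Ring (RegularFn U)] (hR : IsStarRing U)
    (hU : IsSymmetricSliceDomain U) {L : Type*} [DivisionRing L] (ι : RegularFn U →+* L)
    (hι : Function.Injective ι) (hfrac : ∀ x, ∃ a b, a ≠ 0 ∧ x = (ι a)⁻¹ * ι b) :
    Equivalence (SameQuotient U) ∧ ∃ e : QuotientRing U ≃ L, ∀ (f g : RegularFn U) (hf : f.1 ≠ 0),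
      e (QuotientRing.of (starQuotient f.1 g.1) (starQuotient_mem f g hf)) =
        (ι f)⁻¹ * ι g := by
  have := hR.isDomain hU
  have hc := hR.conj_mul_self hU
  have hcent := hR.mul_conj_comm hU
  have hne := hR.conj_ne_zero hU
  -- Coincidence of functions and equality of fractions both amount to the same cross-multiplied
  -- identity in the ring of regular functions.
  have key : ∀ {f g f' g' : RegularFn U} (hf : f.1 ≠ 0) (hf' : f'.1 ≠ 0),
      SameQuotient U ⟨_, starQuotient_mem f g hf⟩ ⟨_, starQuotient_mem f' g' hf'⟩ ↔
        (ι f)⁻¹ * ι g = (ι f')⁻¹ * ι g' := fun hf hf' => by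
    rw [fraction_eq_iff hι hc hcent hne (hR.ne_zero_iff.2 hf) (hR.ne_zero_iff.2 hf')]
    exact hR.starQuotient_eq_iff hU hf hf'
  have hex : ∀ φ : starQuotients U, ∃ f g : RegularFn U, ∃ hf : f.1 ≠ 0,
      φ = ⟨starQuotient f.1 g.1, starQuotient_mem f g hf⟩ := by
    rintro ⟨_, f, g, hf, rfl⟩
    exact ⟨f, g, hf, rfl⟩
  choose num den hnum hφ using hex
  -- The fraction is formed from a chosen numerator and denominator; `hθ'` shows that any other pair
  -- giving the same `*`-quotient yields the same value. Since `θ` is equality-reflecting for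
  -- `SameQuotient`, transitivity of that relation comes for free.
  let θ : starQuotients U → L := fun φ => (ι (num φ))⁻¹ * ι (den φ)
  have hθ : ∀ φ ψ, SameQuotient U φ ψ ↔ θ φ = θ ψ := fun φ ψ => by
    conv_lhs => rw [hφ φ, hφ ψ]
    exact key (hnum φ) (hnum ψ)
  have hθ' : ∀ (f g : RegularFn U) (hf : f.1 ≠ 0),
      θ ⟨starQuotient f.1 g.1, starQuotient_mem f g hf⟩ = (ι f)⁻¹ * ι g := fun f g hf => by
    refine (key (hnum _) hf).1 ?_
    rw [← hφ]
    exact fun q h h' => rfl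
  have hequiv : Equivalence (SameQuotient U) :=
    ⟨fun φ => (hθ φ φ).2 rfl, fun {φ ψ} h => (hθ ψ φ).2 ((hθ φ ψ).1 h).symm,
      fun {φ ψ χ} h h' => (hθ φ χ).2 (((hθ φ ψ).1 h).trans ((hθ ψ χ).1 h'))⟩
  refine ⟨hequiv, Equiv.ofBijective (Quot.lift θ fun φ ψ h => (hθ φ ψ).1 h) ⟨?_, fun x => ?_⟩,
    hθ'⟩
  · rintro ⟨φ⟩ ⟨ψ⟩ h
    exact Quot.sound ((hθ φ ψ).2 h)
  · obtain ⟨a, b, ha, rfl⟩ := hfrac x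
    have ha' := hR.ne_zero_iff.1 ha
    exact ⟨QuotientRing.of _ (starQuotient_mem a b ha'), hθ' a b ha'⟩

theorem starQuotient_regular (hU : IsSymmetricSliceDomain U) {φ : ℍ[ℝ] →. ℍ[ℝ]}
    (hφ : φ ∈ starQuotients U) : IsSymmetricSliceDomain φ.Dom ∧ IsSliceRegular φ.asSubtype := by
  obtain ⟨f, g, hf, rfl⟩ := hφ
  obtain ⟨P, hP⟩ := exists_stem hU f.2
  obtain ⟨Q, hQ⟩ := exists_stem hU g.2
  have hD := hP.isSymmetricSliceDomain_recipDomain hU hf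
  exact ⟨hD, (hP.starQuotient hU hQ hf).isSliceRegular hD⟩

theorem QuotientRing.of_congr {φ ψ : ℍ[ℝ] →. ℍ[ℝ]} (h : φ = ψ) (hφ : φ ∈ starQuotients U)
    (hψ : ψ ∈ starQuotients U) : QuotientRing.of φ hφ = QuotientRing.of ψ hψ := by
  subst h
  rfl

end QuotientRing

end SliceRegular

/-! ### The division ring of `*`-quotients -/

open SliceRegular in
theorem mainTheorem1 (Ω : Set ℍ[ℝ]) (hΩ : IsSymmetricSliceDomain Ω) :
    -- the regular conjugate and the `*`-product are well posed
    (∀ U : Set ℍ[ℝ], IsSymmetricSliceDomain U → ∀ f g : RegularFn U,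
      (∀ h, IsRegularConj f.1 h ↔ h = regConj f.1) ∧
      (∀ h, IsStarProduct f.1 g.1 h ↔ h = starMul f.1 g.1)) ∧
    -- `*`-quotients are regular functions on symmetric slice domains
    (∀ φ ∈ starQuotients Ω, IsSymmetricSliceDomain φ.Dom ∧ IsSliceRegular φ.asSubtype) ∧
    -- coincidence on the common domain is an equivalence relation
    Equivalence (SameQuotient Ω) ∧
    -- `*`-quotients are closed under `+` and `*`
    ∃ (hadd : ∀ φ ∈ starQuotients Ω, ∀ ψ ∈ starQuotients Ω, addPFun φ ψ ∈ starQuotients Ω)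
      (hmul : ∀ φ ∈ starQuotients Ω, ∀ ψ ∈ starQuotients Ω, starMulPFun φ ψ ∈ starQuotients Ω)
      (_ : Ring (RegularFn Ω)) (_ : DivisionRing (QuotientRing Ω))
      (ι : RegularFn Ω →+* QuotientRing Ω),
      -- the operations of the ring of regular functions
      (∀ f g : RegularFn Ω, (f + g).1 = f.1 + g.1) ∧
      (∀ f g : RegularFn Ω, (f * g).1 = starMul f.1 g.1) ∧
      -- the operations of the division ring of `*`-quotients
      (∀ (φ ψ : ℍ[ℝ] →. ℍ[ℝ]) (hφ : φ ∈ starQuotients Ω) (hψ : ψ ∈ starQuotients Ω),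
        QuotientRing.of φ hφ + QuotientRing.of ψ hψ =
          QuotientRing.of (addPFun φ ψ) (hadd φ hφ ψ hψ)) ∧
      (∀ (φ ψ : ℍ[ℝ] →. ℍ[ℝ]) (hφ : φ ∈ starQuotients Ω) (hψ : ψ ∈ starQuotients Ω),
        QuotientRing.of φ hφ * QuotientRing.of ψ hψ =
          QuotientRing.of (starMulPFun φ ψ) (hmul φ hφ ψ hψ)) ∧
      -- `ι` is the inclusion `f ↦ f = 1^{-*} * f`, and `f^{-*} * g` is the quotient of `g` by `f`
      (∀ f : RegularFn Ω, starQuotient (fun _ => 1) f.1 = toPFun f.1 ∧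
        ∃ h : toPFun f.1 ∈ starQuotients Ω, ι f = QuotientRing.of (toPFun f.1) h) ∧
      (∀ (f g : RegularFn Ω) (hf : f.1 ≠ 0),
        QuotientRing.of (starQuotient f.1 g.1) (starQuotient_mem f g hf) = (ι f)⁻¹ * ι g) ∧
      -- Ore conditions and classical ring of quotients
      IsLeftOreDomain (RegularFn Ω) ∧ IsRightOreDomain (RegularFn Ω) ∧
      IsClassicalLeftQuotientRing ι ∧ IsClassicalRightQuotientRing ι := by
  obtain ⟨R, hadd', hmul', hone', hzero'⟩ := exists_ring hΩ
  have hR : IsStarRing Ω := ⟨hadd', hmul', hone', hzero'⟩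
  have := hR.isDomain hΩ
  have hc := hR.conj_mul_self hΩ
  have hcent := hR.mul_conj_comm hΩ
  have hne := hR.conj_ne_zero hΩ
  obtain ⟨L, _, κ, hκ, hfrac⟩ := exists_divisionRing_of_conj hc hcent hne
  obtain ⟨hequiv, e, he⟩ := hR.exists_equiv_quotientRing hΩ κ hκ hfrac
  have hadd : ∀ φ ∈ starQuotients Ω, ∀ ψ ∈ starQuotients Ω, addPFun φ ψ ∈ starQuotients Ω := by
    rintro _ ⟨f, g, hf, rfl⟩ _ ⟨f', g', hf', rfl⟩
    rw [hR.addPFun_starQuotient hΩ hf hf']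
    exact starQuotient_mem _ _ (hR.norm_mul_norm_ne_zero hΩ hf hf')
  have hmul : ∀ φ ∈ starQuotients Ω, ∀ ψ ∈ starQuotients Ω,
      starMulPFun φ ψ ∈ starQuotients Ω := by
    rintro _ ⟨f, g, hf, rfl⟩ _ ⟨f', g', hf', rfl⟩
    rw [hR.starMulPFun_starQuotient hΩ hf hf']
    exact starQuotient_mem _ _ (hR.norm_mul_norm_ne_zero hΩ hf hf')
  have hone : (1 : RegularFn Ω).1 ≠ 0 := hR.ne_zero_iff.1 one_ne_zero
  have hincl : ∀ f : RegularFn Ω, starQuotient (1 : RegularFn Ω).1 f.1 = toPFun f.1 := fun f => by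
    rw [hR.one, starQuotient_one hΩ]
  have hmem : ∀ f : RegularFn Ω, toPFun f.1 ∈ starQuotients Ω := fun f =>
    hincl f ▸ starQuotient_mem 1 f hone
  -- The division ring structure comes from the abstract ring of fractions `L`. That its operations
  -- are the concrete sum and `*`-product of functions is checked afterwards by comparing images in
  -- `L`.
  let D : DivisionRing (QuotientRing Ω) := e.divisionRing
  let ε : QuotientRing Ω ≃+* L := e.ringEquiv
  have hε : ∀ (f g : RegularFn Ω) (hf : f.1 ≠ 0),
      ε (QuotientRing.of (starQuotient f.1 g.1) (starQuotient_mem f g hf)) = (κ f)⁻¹ * κ g := he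
  let ι : RegularFn Ω →+* QuotientRing Ω := (ε.symm : L →+* QuotientRing Ω).comp κ
  have hι : ∀ f, ε (ι f) = κ f := fun f => ε.apply_symm_apply _
  have hquot : ∀ (f g : RegularFn Ω) (hf : f.1 ≠ 0),
      QuotientRing.of (starQuotient f.1 g.1) (starQuotient_mem f g hf) = (ι f)⁻¹ * ι g :=
    fun f g hf => ε.injective (by rw [hε f g hf, map_mul, map_inv₀, hι, hι])
  have hinj : Function.Injective ι := ε.symm.injective.comp hκ
  have hunit : ∀ a : RegularFn Ω, a ≠ 0 → IsUnit (ι a) := fun a ha =>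
    isUnit_iff_ne_zero.2 ((map_ne_zero_iff ι hinj).2 ha)
  have hleft : ∀ x : QuotientRing Ω, ∃ a b : RegularFn Ω, a ≠ 0 ∧ x = (ι a)⁻¹ * ι b := fun x => by
    obtain ⟨a, b, ha, hx⟩ := hfrac (ε x)
    exact ⟨a, b, ha, ε.injective (by rw [hx, map_mul, map_inv₀, hι, hι])⟩
  refine ⟨fun U hU f g => ⟨fun h => isRegularConj_iff hU f.2, fun h => isStarProduct_iff hU f.2 g.2⟩,
    fun φ hφ => starQuotient_regular hΩ hφ, hequiv, hadd, hmul, R, D, ι, hadd', hmul', ?_, ?_, ?_,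
    hquot, isLeftOreDomain_of_conj hc hcent hne, isRightOreDomain_of_conj hcent hne,
    ⟨hinj, hunit, hleft⟩, ⟨hinj, hunit, fun x => ?_⟩⟩
  · rintro _ _ ⟨f, g, hf, rfl⟩ ⟨f', g', hf', rfl⟩
    rw [QuotientRing.of_congr (hR.addPFun_starQuotient hΩ hf hf') _
      (starQuotient_mem _ _ (hR.norm_mul_norm_ne_zero hΩ hf hf'))]
    apply ε.injective
    rw [map_add, hε f g hf, hε f' g' hf',
      hε _ _ (hR.norm_mul_norm_ne_zero hΩ hf hf'), fraction_add hκ hc hcent hne (hR.ne_zero_iff.2 hf)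
      (hR.ne_zero_iff.2 hf')]
  · rintro _ _ ⟨f, g, hf, rfl⟩ ⟨f', g', hf', rfl⟩
    rw [QuotientRing.of_congr (hR.starMulPFun_starQuotient hΩ hf hf') _
      (starQuotient_mem _ _ (hR.norm_mul_norm_ne_zero hΩ hf hf'))]
    apply ε.injective
    rw [map_mul, hε f g hf, hε f' g' hf',
      hε _ _ (hR.norm_mul_norm_ne_zero hΩ hf hf'), fraction_mul hκ hc hcent hne (hR.ne_zero_iff.2 hf)
      (hR.ne_zero_iff.2 hf')]
  · refine fun f => ⟨starQuotient_one hΩ f, hmem f, ?_⟩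
    rw [← QuotientRing.of_congr (hincl f) (starQuotient_mem 1 f hone), hquot 1 f hone, map_one, inv_one,
      one_mul]
  · obtain ⟨a, b, ha, rfl⟩ := hleft x
    -- The right denominator is the norm of the left one.
    exact ⟨_, _, mul_ne_zero ha (hne a ha), exists_right_fraction hinj hc hcent hne ha⟩
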